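/- \textbf{Setting.} Let $G=(V,E)$ be a finite directed graph with $n=|V|$ nodes and propagation probabilities $p_e\in[0,1]$, let $S_r\subsetneq V$ be the rumor seed set, and let $1\le k\le n$ be an integer. For $S_p\subseteq V$, two cascades spread as follows. At time $0$ the nodes of $S_r$ are activated by the rumor and those of $S_p\setminus S_r$ by the positive cascade. At time $t>0$ each node $u$ activated at time $t-1$ attempts once, independently, to activate each inactive out-neighbor $v$, with success probability $p_{(u,v)}$; a node joins the cascade that activates it, the rumor if both succeed simultaneously, and never changes its state again. Let $f(S_p)$ be the expected number of nodes that are not activated by the rumor when the process stops, and let $OPT_k=\max_{|S|\le k} f(S)$. \textbf{Random R-tuples.} Choose $v\in V$ uniformly at random and set $V^*=E_t=E_f=\emptyset$, $V_1=\{v\}$. Repeat: if $V_1=\emptyset$, return $(V^*,E_t,E_f,B)$ with $B=0$; if $V_1\cap S_r\ne\emptyset$, return it with $B=1$; otherwise add $V_1$ to $V^*$ and test independently each not yet tested edge $(u_2,u_1)\in E$ with $u_1\in V^*$, $u_2\notin V^*$, which succeeds with probability $p_{(u_2,u_1)}$; add the successful edges to $E_t$, the others to $E_f$, and let $V_1$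 be the set of tails $u_2$ of the successful edges. For an R-tuple $T$ let $x(S,T)=1$ if $S\cap T(V^*)\neq\emptyset$ or $T(B)=0$, and $x(S,T)=0$ otherwise; for a finite family $R$ of R-tuples let $F(S,R)=\sum_{T\in R}x(S,T)$. \textbf{Node selection.} Given $R$, take the sets $T(V^*)$ for $T\in R$, replaced by $V$ when $T(B)=0$. Let $S'$ be the result of $k$ greedy steps, each of which picks a node that lies in the largest number of the not yet covered sets (ties broken by an arbitrary fixed rule) and discards the sets that contain it. \textbf{Estimation of $OPT_k$.} Let $\delta>0$, $N>0$ be real and $\lambda=n(2+\delta)\ln\!\big(N\binom nk\log_2 n\big)/\delta^2$. Start with $R=\emptyset$. For $i=1,\dots,\lfloor\log_2(n-1)\rfloor$ (no iterations if $n=1$): put $x_i=n/2^i$, $l_i=\lambda/x_i$; while $|R|\le l_i$, add a fresh independent random R-tuple to $R$; compute $S'$ from $R$; if $nF(S',R)/l_i\ge(1+\delta)x_i$, return $OPT_k^*=\frac{nF(S',R)}{l_i(1+\delta)}$ and stop. If no iteration returns a value, set $OPT_k^*=1$. \textbf{Theorem.} With probability at least $1-3/N$, $$OPT_k\ \ge\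 OPT_k^*\ \ge\ \frac{(1-1/e)\,OPT_k}{2(1+\delta)^2}.$$ Moreover, if $\frac{(1-1/e)\,OPT_k}{(1+\delta)^2}\ge n/2^{\lfloor\log_2(n-1)\rfloor}$ (where the exponent is read as $0$ if $n=1$), then with probability at least $1-3/N$ one of the iterations returns a value $OPT_k^*$ and this value satisfies both inequalities. -/

import Mathlib

open scoped NNReal ENNReal

namespace RumorBlocking

/-- The random subset of `D` that contains each `a ∈ D` independently with probability `p a`. -/
noncomputable def coins {α : Type*} [Fintype α] [DecidableEq α] (p : α → ℝ≥0)
    (hp : ∀ a, p a ≤ 1) (D : Finset α) : PMF (Finset α) :=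
  PMF.ofFintype
    (fun A => ((if A ⊆ D then (∏ a ∈ A, p a) * ∏ a ∈ D \ A, (1 - p a) else 0 : ℝ≥0) : ℝ≥0∞))
    (by
      have h : (∑ A : Finset α,
          (if A ⊆ D then (∏ a ∈ A, p a) * ∏ a ∈ D \ A, (1 - p a) else 0)) = 1 := by
        rw [← Finset.sum_filter]
        have h1 : (Finset.univ.filter fun A : Finset α => A ⊆ D) = D.powerset := by
          ext A; simp
        rw [h1, ← Finset.prod_add]
        exact Finset.prod_eq_one fun a _ => add_tsub_cancel_of_le (hp a)
      exact_mod_cast h)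

/-- An independent cascade network: a finite directed graph (an edge `(u, v)` goes from `u` to
`v`) with a propagation probability on each edge. Values of `prob` off `edges` are never used. -/
structure ICNetwork (V : Type*) where
  edges : Finset (V × V)
  prob : V × V → ℝ≥0
  prob_le_one : ∀ e, prob e ≤ 1

/-- A state of the two-cascade diffusion: the nodes activated so far by the rumor and by the
positive cascade, and the nodes (of either kind) activated at the last time step. -/
structure DiffusionState (V : Type*) where
  rumor : Finset V
  positive : Finset V
  newlyActive : Finset V

/-- A reverse tuple `(V*, E_t, E_f, B)`. -/
structure RTuple (V : Type*) where
  nodes : Finset V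
  edgesTrue : Finset (V × V)
  edgesFalse : Finset (V × V)
  hit : Bool

section

variable {V : Type*} [Fintype V] [DecidableEq V]

/-! ### The diffusion process and the objective function -/

/-- One time step: each node activated at the previous step attempts once, independently, to
activate each of its inactive out-neighbors; when both cascades succeed on a node, the rumor
wins. -/
noncomputable def diffusionStep (G : ICNetwork V) (s : DiffusionState V) :
    PMF (DiffusionState V) :=
  (coins G.prob G.prob_le_one
    (G.edges.filter fun e => e.1 ∈ s.newlyActive ∧ e.2 ∉ s.rumor ∪ s.positive)).bind fun A =>
      let newRumor := (A.filter fun e => e.1 ∈ s.rumor).image Prod.snd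
      let newPositive := (A.filter fun e => e.1 ∈ s.positive).image Prod.snd \ newRumor
      PMF.pure ⟨s.rumor ∪ newRumor, s.positive ∪ newPositive, newRumor ∪ newPositive⟩

/-- The state after `t` further time steps. -/
noncomputable def diffusionRun (G : ICNetwork V) : ℕ → DiffusionState V → PMF (DiffusionState V)
  | 0, s => PMF.pure s
  | t + 1, s => (diffusionStep G s).bind (diffusionRun G t)

/-- Time `0`: the seeds are activated, the rumor having priority on common seeds. -/
def initialState (Sr Sp : Finset V) : DiffusionState V := ⟨Sr, Sp \ Sr, Sr ∪ Sp⟩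

/-- The final set of rumor-activated nodes. Until the process stops each time step activates a new
node, so that it has stopped after `|V|` time steps. -/
noncomputable def finalRumor (G : ICNetwork V) (Sr Sp : Finset V) : PMF (Finset V) :=
  (diffusionRun G (Fintype.card V) (initialState Sr Sp)).map DiffusionState.rumor

/-- `f(Sp)`: the expected number of nodes that are not activated by the rumor. -/
noncomputable def blocked (G : ICNetwork V) (Sr Sp : Finset V) : ℝ :=
  ∑ A : Finset V, (finalRumor G Sr Sp A).toReal * ((Aᶜ).card : ℝ)

/-- `OPT_k`: the maximum of `f` over the seed sets with at most `k` nodes. -/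
noncomputable def OPT (G : ICNetwork V) (Sr : Finset V) (k : ℕ) : ℝ :=
  (Finset.univ.filter fun S : Finset V => S.card ≤ k).sup' ⟨∅, by simp⟩ (blocked G Sr)

/-! ### Random reverse tuples -/

/-- The loop of the reverse breadth-first sampling, with current values `Vs` of `V*`, `V1` of the
layer reached last, and `Et`, `Ef` of the edges tested with success and with failure. Each
edge is tested at most once. The first argument bounds the number of rounds. -/
noncomputable def rTupleLoop (G : ICNetwork V) (Sr : Finset V) :
    ℕ → Finset V → Finset V → Finset (V × V) → Finset (V × V) → PMF (RTuple V)
  | 0, Vs, _, Et, Ef => PMF.pure ⟨Vs, Et, Ef, false⟩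
  | r + 1, Vs, V1, Et, Ef =>
    if V1 = ∅ then PMF.pure ⟨Vs, Et, Ef, false⟩
    else if (V1 ∩ Sr).Nonempty then PMF.pure ⟨Vs, Et, Ef, true⟩
    else
      let Vs' := Vs ∪ V1
      let tested := G.edges.filter fun e => e.2 ∈ Vs' ∧ e.1 ∉ Vs' ∧ e ∉ Et ∪ Ef
      (coins G.prob G.prob_le_one tested).bind fun A =>
        rTupleLoop G Sr r Vs' (A.image Prod.fst) (Et ∪ A) (Ef ∪ (tested \ A))

/-- A random R-tuple of `v`. Every round that does not return adds a node to `V*`, so the loop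
always returns within `|V| + 1` rounds. -/
noncomputable def rTupleOf (G : ICNetwork V) (Sr : Finset V) (v : V) : PMF (RTuple V) :=
  rTupleLoop G Sr (Fintype.card V + 1) ∅ {v} ∅ ∅

/-- A random R-tuple: that of a uniformly random node. -/
noncomputable def randomRTuple [Nonempty V] (G : ICNetwork V) (Sr : Finset V) : PMF (RTuple V) :=
  (PMF.uniformOfFintype V).bind (rTupleOf G Sr)

/-- `x(S, T)`. -/
def cover (S : Finset V) (T : RTuple V) : ℕ :=
  if (S ∩ T.nodes).Nonempty ∨ T.hit = false then 1 else 0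

/-- `F(S, R)`. -/
def totalCover (S : Finset V) (R : List (RTuple V)) : ℕ :=
  (R.map (cover S)).sum

/-! ### Greedy node selection -/

/-- The number of sets in the list `L` that contain `v`. -/
def coverCount (L : List (Finset V)) (v : V) : ℕ :=
  L.countP fun A => decide (v ∈ A)

/-- A rule that, given the nodes selected so far and the sets not yet covered, picks a node
contained in the largest number of these sets, with ties broken arbitrarily. -/
def IsGreedyRule (pick : Finset V → List (Finset V) → V) : Prop :=
  ∀ S L v, coverCount L v ≤ coverCount L (pick S L)

/-- `k` rounds of greedy selection, from the selected nodes `S` and the uncovered sets `L`. -/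
def greedy (pick : Finset V → List (Finset V) → V) :
    ℕ → Finset V → List (Finset V) → Finset V
  | 0, S, _ => S
  | k + 1, S, L =>
    let v := pick S L
    greedy pick k (insert v S) (L.filter fun A => decide (v ∉ A))

/-- Node-Selection: greedy maximum coverage of the sets `T(V*)`, where `T(V*)` is replaced by `V`
if `T(B) = 0`. -/
def nodeSelection (pick : Finset V → List (Finset V) → V) (R : List (RTuple V)) (k : ℕ) :
    Finset V :=
  greedy pick k ∅ (R.map fun T => if T.hit = true then T.nodes else Finset.univ)

/-! ### The doubling test that estimates `OPT_k` -/

/-- Insert `c` further independent random R-tuples into `R`. -/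
noncomputable def generate [Nonempty V] (G : ICNetwork V) (Sr : Finset V) :
    ℕ → List (RTuple V) → PMF (List (RTuple V))
  | 0, R => PMF.pure R
  | c + 1, R => (randomRTuple G Sr).bind fun T => generate G Sr c (T :: R)

/-- `λ = n (2 + δ) ln (N * (n choose k) * log₂ n) / δ²`. -/
noncomputable def lam (n k : ℕ) (δ N : ℝ) : ℝ :=
  (n : ℝ) * (2 + δ) * Real.log (N * (n.choose k : ℝ) * Real.logb 2 n) / δ ^ 2

/-- `x_i = n / 2 ^ i`. -/
noncomputable def xVal (n i : ℕ) : ℝ := (n : ℝ) / 2 ^ i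

/-- `l_i = λ / x_i`. -/
noncomputable def lVal (n k : ℕ) (δ N : ℝ) (i : ℕ) : ℝ := lam n k δ N / xVal n i

/-- The last index of the loop, `⌊log₂ (n - 1)⌋`. -/
def lastIter (n : ℕ) : ℕ := Nat.log 2 (n - 1)

/-- At most `r` iterations of the test, from iteration `i` and the current list `R`. R-tuples are
inserted as long as `|R| ≤ l_i`, that is, until `|R| ≥ ⌊l_i⌋ + 1`. The value is `none` if the
iterations are exhausted before the test has returned an estimate. -/
noncomputable def estimateLoop [Nonempty V] (G : ICNetwork V) (Sr : Finset V) (k : ℕ) (δ N : ℝ)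
    (pick : Finset V → List (Finset V) → V) : ℕ → ℕ → List (RTuple V) → PMF (Option ℝ)
  | 0, _, _ => PMF.pure none
  | r + 1, i, R =>
    let n := Fintype.card V
    let x := xVal n i
    let l := lVal n k δ N i
    (generate G Sr ((⌊l⌋ + 1).toNat - R.length) R).bind fun R' =>
      let F : ℝ := (totalCover (nodeSelection pick R' k) R' : ℝ)
      open Classical in
      if (1 + δ) * x ≤ n * F / l then PMF.pure (some (n * F / (l * (1 + δ))))
      else estimateLoop G Sr k δ N pick r (i + 1) R'

/-- The output of the estimation algorithm, which runs the iterations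
`i = 1, …, ⌊log₂ (n - 1)⌋`; `none` means that no iteration returned a value. -/
noncomputable def optEstimate [Nonempty V] (G : ICNetwork V) (Sr : Finset V) (k : ℕ) (δ N : ℝ)
    (pick : Finset V → List (Finset V) → V) : PMF (Option ℝ) :=
  estimateLoop G Sr k δ N pick (lastIter (Fintype.card V)) 1 []

/-- `y` is an estimate of `OPT_k` with the guaranteed accuracy. -/
def IsGoodEstimate (G : ICNetwork V) (Sr : Finset V) (k : ℕ) (δ : ℝ) (y : ℝ) : Prop :=
  y ≤ OPT G Sr k ∧ (1 - 1 / Real.exp 1) * OPT G Sr k / (2 * (1 + δ) ^ 2) ≤ y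

end

end RumorBlocking

namespace RumorBlocking

/-! ### Expectations of extended nonnegative functions -/

section Expectation

variable {α β : Type*}

/-- The expectation of an extended nonnegative function. -/
noncomputable def expect (p : PMF α) (f : α → ℝ≥0∞) : ℝ≥0∞ := ∑' a, p a * f a

lemma expect_pure (a : α) (f : α → ℝ≥0∞) : expect (PMF.pure a) f = f a := by
  unfold expect
  rw [tsum_eq_single a]
  · simp
  · intro b hb
    simp [PMF.pure_apply, hb]

lemma expect_bind (p : PMF α) (g : α → PMF β) (f : β → ℝ≥0∞) :
    expect (p.bind g) f = expect p fun a => expect (g a) f := by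
  unfold expect
  simp only [PMF.bind_apply, ← ENNReal.tsum_mul_right, ← ENNReal.tsum_mul_left]
  rw [ENNReal.tsum_comm]
  simp only [mul_assoc]

lemma expect_map (p : PMF α) (g : α → β) (f : β → ℝ≥0∞) :
    expect (p.map g) f = expect p fun a => f (g a) := by
  rw [← PMF.bind_pure_comp, expect_bind]
  simp [expect_pure]

lemma expect_mono {p : PMF α} {f g : α → ℝ≥0∞} (h : ∀ a ∈ p.support, f a ≤ g a) :
    expect p f ≤ expect p g := by
  refine ENNReal.tsum_le_tsum fun a => ?_
  by_cases ha : a ∈ p.support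
  · exact mul_le_mul_right (h a ha) _
  · simp [(PMF.apply_eq_zero_iff p a).2 ha]

lemma expect_congr {p : PMF α} {f g : α → ℝ≥0∞} (h : ∀ a ∈ p.support, f a = g a) :
    expect p f = expect p g :=
  le_antisymm (expect_mono fun a ha => (h a ha).le) (expect_mono fun a ha => (h a ha).ge)

lemma expect_const (p : PMF α) (c : ℝ≥0∞) : expect p (fun _ => c) = c := by
  unfold expect
  rw [ENNReal.tsum_mul_right, p.tsum_coe, one_mul]

lemma expect_add (p : PMF α) (f g : α → ℝ≥0∞) :
    expect p (fun a => f a + g a) = expect p f + expect p g := by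
  unfold expect
  simp only [mul_add, ENNReal.tsum_add]

lemma expect_mul_left (p : PMF α) (c : ℝ≥0∞) (f : α → ℝ≥0∞) :
    expect p (fun a => c * f a) = c * expect p f := by
  unfold expect
  rw [← ENNReal.tsum_mul_left]
  exact tsum_congr fun a => by ring

lemma expect_sum {ι : Type*} (p : PMF α) (s : Finset ι) (f : ι → α → ℝ≥0∞) :
    expect p (fun a => ∑ i ∈ s, f i a) = ∑ i ∈ s, expect p (f i) := by
  classical
  induction s using Finset.induction_on with
  | empty => simp [expect_const]
  | insert i s hi ih => simp only [Finset.sum_insert hi, expect_add, ih]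

lemma toOuterMeasure_eq_expect (p : PMF α) (s : Set α) :
    p.toOuterMeasure s = expect p (s.indicator 1) := by
  rw [PMF.toOuterMeasure_apply]
  refine tsum_congr fun a => ?_
  by_cases ha : a ∈ s <;> simp [ha]

lemma toOuterMeasure_le_one (p : PMF α) (s : Set α) : p.toOuterMeasure s ≤ 1 := by
  rw [toOuterMeasure_eq_expect, ← expect_const p 1]
  exact expect_mono fun a _ => Set.indicator_le_self' (fun _ _ => zero_le) a

lemma one_sub_le_toOuterMeasure (p : PMF α) (s : Set α) {ε : ℝ≥0∞}
    (h : p.toOuterMeasure sᶜ ≤ ε) : 1 - ε ≤ p.toOuterMeasure s := by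
  rw [tsub_le_iff_right]
  calc (1 : ℝ≥0∞) = expect p fun _ => 1 := (expect_const p 1).symm
    _ = expect p fun a => s.indicator 1 a + sᶜ.indicator 1 a := by
        refine expect_congr fun a _ => ?_
        by_cases ha : a ∈ s <;> simp [ha]
    _ = p.toOuterMeasure s + p.toOuterMeasure sᶜ := by
        rw [expect_add, toOuterMeasure_eq_expect, toOuterMeasure_eq_expect]
    _ ≤ _ := by gcongr

lemma bind_congr_support {p : PMF α} {f g : α → PMF β} (h : ∀ a ∈ p.support, f a = g a) :
    p.bind f = p.bind g := by
  ext b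
  simp only [PMF.bind_apply]
  refine tsum_congr fun a => ?_
  by_cases ha : a ∈ p.support
  · rw [h a ha]
  · simp [(PMF.apply_eq_zero_iff p a).2 ha]

end Expectation

/-! ### Deferred decisions for independent coins -/

section Coins

variable {α β : Type*} [Fintype α] [DecidableEq α] (p : α → ℝ≥0) (hp : ∀ a, p a ≤ 1)

lemma coins_apply (D A : Finset α) : coins p hp D A =
    ((if A ⊆ D then ∏ a ∈ D, (if a ∈ A then p a else 1 - p a) else 0 : ℝ≥0) : ℝ≥0∞) := by
  unfold coins
  rw [PMF.ofFintype_apply]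
  congr 1
  split_ifs with h
  · rw [← Finset.prod_sdiff h, mul_comm]
    congr 1
    · exact Finset.prod_congr rfl fun a ha => by simp [(Finset.mem_sdiff.1 ha).2]
    · exact Finset.prod_congr rfl fun a ha => by simp [ha]
  · rfl

lemma subset_of_mem_support_coins {D A : Finset α} (h : A ∈ (coins p hp D).support) : A ⊆ D := by
  by_contra hA
  rw [PMF.mem_support_iff, coins_apply, if_neg hA] at h
  simp at h

lemma coins_union {D D' : Finset α} (h : Disjoint D D') :
    coins p hp (D ∪ D') =
      (coins p hp D).bind fun A => (coins p hp D').bind fun A' => PMF.pure (A ∪ A') := by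
  have key : ∀ A B B' : Finset α, B ⊆ D → B' ⊆ D' → A = B ∪ B' → B = A ∩ D ∧ B' = A ∩ D' := by
    rintro A B B' hB hB' rfl
    rw [Finset.disjoint_left] at h
    constructor <;> ext x <;> simp only [Finset.mem_inter, Finset.mem_union] <;>
      have := @hB x <;> have := @hB' x <;> have := @h x <;> tauto
  ext A
  rw [PMF.bind_apply, tsum_eq_single (A ∩ D), PMF.bind_apply, tsum_eq_single (A ∩ D')]
  · by_cases hA : A ⊆ D ∪ D'
    · have h1 : A = A ∩ D ∪ A ∩ D' := by
        rw [← Finset.inter_union_distrib_left, Finset.inter_eq_left.2 hA]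
      rw [PMF.pure_apply, if_pos h1, mul_one, coins_apply, coins_apply, coins_apply, if_pos hA,
        if_pos Finset.inter_subset_right, if_pos Finset.inter_subset_right, ← ENNReal.coe_mul,
        Finset.prod_union h]
      congr 2
      · exact Finset.prod_congr rfl fun a ha => by simp [ha]
      · exact Finset.prod_congr rfl fun a ha => by simp [ha]
    · rw [PMF.pure_apply, if_neg, coins_apply, if_neg hA]
      · simp
      · intro h1
        exact hA (h1 ▸ Finset.union_subset_union Finset.inter_subset_right
          Finset.inter_subset_right)
  · intro B hB
    by_cases h1 : B ∈ (coins p hp D').support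
    · rw [PMF.pure_apply, if_neg, mul_zero]
      intro h2
      exact hB (key A _ _ Finset.inter_subset_right (subset_of_mem_support_coins p hp h1) h2).2
    · rw [(PMF.apply_eq_zero_iff _ _).2 h1, zero_mul]
  · intro B hB
    by_cases h1 : B ∈ (coins p hp D).support
    · rw [mul_eq_zero]
      right
      rw [PMF.bind_apply, ENNReal.tsum_eq_zero]
      intro B'
      by_cases h2 : B' ∈ (coins p hp D').support
      · rw [PMF.pure_apply, if_neg, mul_zero]
        intro h3
        exact hB (key A _ _ (subset_of_mem_support_coins p hp h1)
          (subset_of_mem_support_coins p hp h2) h3).1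
      · rw [(PMF.apply_eq_zero_iff _ _).2 h2, zero_mul]
    · rw [(PMF.apply_eq_zero_iff _ _).2 h1, zero_mul]

/-- Principle of deferred decisions: the coins in `D` may be tossed separately, if afterwards the
outcome on `D` is not looked at any more. -/
lemma coins_bind_deferred {D E : Finset α} (hD : D ⊆ E) (g : Finset α → Finset α → PMF β)
    (hg : ∀ A ⊆ D, ∀ B C, B \ D = C \ D → g A B = g A C) :
    (coins p hp E).bind (fun A => g (A ∩ D) A) =
      (coins p hp D).bind fun A => (coins p hp E).bind (g A) := by
  have hE := coins_union p hp (Finset.disjoint_sdiff (s := D) (t := E))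
  rw [Finset.union_sdiff_of_subset hD] at hE
  rw [hE]
  simp only [PMF.bind_bind, PMF.pure_bind]
  refine bind_congr_support fun A hA => ?_
  have hA' := subset_of_mem_support_coins p hp hA
  have h2 : ∀ A₁ ⊆ D, ((coins p hp (E \ D)).bind fun B => g A (A₁ ∪ B)) =
      (coins p hp (E \ D)).bind fun B => g A B := by
    intro A₁ hA₁
    refine bind_congr_support fun B _ => hg A hA' _ _ ?_
    rw [Finset.union_sdiff_distrib, Finset.sdiff_eq_empty_iff_subset.2 hA₁, Finset.empty_union]
  calc _ = (coins p hp (E \ D)).bind fun B => g A (A ∪ B) := by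
        refine bind_congr_support fun B hB => ?_
        have hB' := subset_of_mem_support_coins p hp hB
        congr 1
        ext x
        have := @hA' x
        have := @hB' x
        simp only [Finset.mem_inter, Finset.mem_union, Finset.mem_sdiff] at *
        tauto
    _ = (coins p hp D).bind fun A₁ => (coins p hp (E \ D)).bind fun B => g A B := by
        rw [h2 A hA', PMF.bind_const]
    _ = _ := bind_congr_support fun A₁ hA₁ =>
        (h2 A₁ (subset_of_mem_support_coins p hp hA₁)).symm

end Coins

/-! ### The live-edge description of the diffusion and of the reverse sampling -/

section LiveEdge

variable {V : Type*}

/-- `v` can be reached from `u` by a path of at most `t` edges in `A`. -/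
def Reach (A : Finset (V × V)) : ℕ → V → V → Prop
  | 0, u, v => u = v
  | t + 1, u, v => Reach A t u v ∨ ∃ w, Reach A t u w ∧ (w, v) ∈ A

lemma Reach.mono {A : Finset (V × V)} {u v : V} {s t : ℕ} (h : Reach A s u v) (hst : s ≤ t) :
    Reach A t u v := by
  induction hst with
  | refl => exact h
  | step _ ih => exact Or.inl ih

lemma reach_succ_iff_head {A : Finset (V × V)} {t : ℕ} {u v : V} :
    Reach A (t + 1) u v ↔ Reach A t u v ∨ ∃ w, (u, w) ∈ A ∧ Reach A t w v := by
  induction t generalizing v with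
  | zero =>
    simp only [Reach]
    constructor
    · rintro (h | ⟨w, rfl, h⟩)
      · exact Or.inl h
      · exact Or.inr ⟨v, h, rfl⟩
    · rintro (h | ⟨w, h, rfl⟩)
      · exact Or.inl h
      · exact Or.inr ⟨u, rfl, h⟩
  | succ t ih =>
    constructor
    · rintro (h | ⟨x, hx, hxv⟩)
      · exact Or.inl h
      · rcases ih.1 hx with h | ⟨w, hw, hwx⟩
        · exact Or.inl (Or.inr ⟨x, h, hxv⟩)
        · exact Or.inr ⟨w, hw, Or.inr ⟨x, hwx, hxv⟩⟩
    · rintro (h | ⟨w, hw, h | ⟨x, hx, hxv⟩⟩)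
      · exact Or.inl h
      · exact Or.inl (ih.2 (Or.inr ⟨w, hw, h⟩))
      · exact Or.inr ⟨x, ih.2 (Or.inr ⟨w, hw, hx⟩), hxv⟩

/-- Along the live edges `A`, the rumor reaches `v` within `t` steps and not later than the
positive cascade. -/
def LostBy (A : Finset (V × V)) (Sr S : Finset V) (t : ℕ) (v : V) : Prop :=
  ∃ j ≤ t, (∃ u ∈ Sr, Reach A j u v) ∧ ∀ i < j, ∀ u ∈ S, ¬ Reach A i u v

variable [DecidableEq V]

/-- The edges tested in one step of the diffusion. -/
def stepEdges (G : ICNetwork V) (s : DiffusionState V) : Finset (V × V) :=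
  G.edges.filter fun e => e.1 ∈ s.newlyActive ∧ e.2 ∉ s.rumor ∪ s.positive

/-- The state after one step of the diffusion in which the edges of `A` succeeded. -/
def nextState (s : DiffusionState V) (A : Finset (V × V)) : DiffusionState V :=
  let newRumor := (A.filter fun e => e.1 ∈ s.rumor).image Prod.snd
  let newPositive := (A.filter fun e => e.1 ∈ s.positive).image Prod.snd \ newRumor
  ⟨s.rumor ∪ newRumor, s.positive ∪ newPositive, newRumor ∪ newPositive⟩

/-- The diffusion along a fixed set of live edges. -/
def liveRun (G : ICNetwork V) : ℕ → DiffusionState V → Finset (V × V) → DiffusionState V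
  | 0, s, _ => s
  | t + 1, s, A => liveRun G t (nextState s (A ∩ stepEdges G s)) A

lemma liveRun_congr (G : ICNetwork V) {t : ℕ} {s : DiffusionState V} {A B : Finset (V × V)}
    (h : ∀ e : V × V, (e.1 ∈ s.newlyActive ∨ e.1 ∉ s.rumor ∪ s.positive) → (e ∈ A ↔ e ∈ B)) :
    liveRun G t s A = liveRun G t s B := by
  induction t generalizing s with
  | zero => rfl
  | succ t ih =>
    have h1 : A ∩ stepEdges G s = B ∩ stepEdges G s := by
      ext e
      simp only [Finset.mem_inter, stepEdges, Finset.mem_filter]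
      constructor
      · rintro ⟨h1, h2, h3, h4⟩
        exact ⟨(h e (Or.inl h3)).1 h1, h2, h3, h4⟩
      · rintro ⟨h1, h2, h3, h4⟩
        exact ⟨(h e (Or.inl h3)).2 h1, h2, h3, h4⟩
    simp only [liveRun, h1]
    refine ih fun e he => h e (Or.inr ?_)
    rcases he with he | he
    · simp only [nextState, Finset.mem_union, Finset.mem_sdiff, Finset.mem_image,
        Finset.mem_filter, Finset.mem_inter, stepEdges] at he
      rcases he with ⟨e', he', h2⟩ | ⟨⟨e', he', h2⟩, -⟩ <;>
      · rw [← h2, Finset.mem_union]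
        exact he'.1.2.2.2
    · intro h2
      refine he ?_
      simp only [nextState, Finset.mem_union] at h2 ⊢
      tauto

lemma newlyActive_nextState_subset (s : DiffusionState V) (A : Finset (V × V)) :
    (nextState s A).newlyActive ⊆ (nextState s A).rumor ∪ (nextState s A).positive := by
  intro v hv
  simp only [nextState, Finset.mem_union] at hv ⊢
  tauto

lemma diffusionRun_eq [Fintype V] (G : ICNetwork V) (t : ℕ) (s : DiffusionState V)
    (hs : s.newlyActive ⊆ s.rumor ∪ s.positive) :
    diffusionRun G t s =
      (coins G.prob G.prob_le_one G.edges).bind fun A => PMF.pure (liveRun G t s A) := by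
  induction t generalizing s with
  | zero => simp [diffusionRun, liveRun, PMF.bind_const]
  | succ t ih =>
    have h1 : diffusionRun G (t + 1) s =
        (coins G.prob G.prob_le_one (stepEdges G s)).bind fun A =>
          diffusionRun G t (nextState s A) := by
      simp only [diffusionRun, diffusionStep, PMF.bind_bind, PMF.pure_bind]
      rfl
    have h2 := coins_bind_deferred G.prob G.prob_le_one (D := stepEdges G s) (E := G.edges)
      (Finset.filter_subset _ _) (fun A B => PMF.pure (liveRun G t (nextState s A) B)) ?_
    · rw [h1]
      simp only [ih _ (newlyActive_nextState_subset s _)]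
      exact h2.symm
    · intro A hA B C hBC
      rw [liveRun_congr]
      intro e he
      have h3 : e ∉ stepEdges G s := by
        intro h4
        have h5 := (Finset.mem_filter.1 h4).2.1
        rcases he with he | he
        · have h6 : e.1 ∉ s.rumor ∪ s.positive := by
            simp only [nextState, Finset.mem_union, Finset.mem_sdiff, Finset.mem_image,
              Finset.mem_filter] at he
            rcases he with ⟨e', he', h2⟩ | ⟨⟨e', he', h2⟩, -⟩ <;>
            · rw [← h2]
              exact (Finset.mem_filter.1 (hA he'.1)).2.2
          exact h6 (hs h5)
        · refine he ?_
          have := hs h5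
          simp only [nextState, Finset.mem_union] at this ⊢
          tauto
      have h4 := Finset.ext_iff.1 hBC e
      simpa [h3] using h4

/-- The state of the diffusion after `t` steps along the live edges `A`. -/
structure IsLiveState (A : Finset (V × V)) (Sr S : Finset V) (t : ℕ)
    (s : DiffusionState V) : Prop where
  rumor : ∀ v, v ∈ s.rumor ↔ LostBy A Sr S t v
  positive : ∀ v, v ∈ s.positive ↔ v ∉ s.rumor ∧ ∃ u ∈ Sr ∪ S, Reach A t u v
  newly : ∀ v, v ∈ s.newlyActive ↔
    (∃ u ∈ Sr ∪ S, Reach A t u v) ∧ ∀ i < t, ¬ ∃ u ∈ Sr ∪ S, Reach A i u v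

lemma isLiveState_initialState (A : Finset (V × V)) (Sr S : Finset V) :
    IsLiveState A Sr S 0 (initialState Sr S) where
  rumor v := by simp [initialState, LostBy, Reach]
  positive v := by
    simp only [initialState, Reach, Finset.mem_sdiff, Finset.mem_union, exists_eq_right]
    tauto
  newly v := by simp [initialState, Reach]

lemma IsLiveState.active_iff {A : Finset (V × V)} {Sr S : Finset V} {t : ℕ}
    {s : DiffusionState V} (h : IsLiveState A Sr S t s) (v : V) :
    v ∈ s.rumor ∪ s.positive ↔ ∃ u ∈ Sr ∪ S, Reach A t u v := by
  rw [Finset.mem_union, h.positive]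
  have : v ∈ s.rumor → ∃ u ∈ Sr ∪ S, Reach A t u v := by
    rw [h.rumor]
    rintro ⟨j, hj, ⟨u, hu, huv⟩, -⟩
    exact ⟨u, Finset.mem_union_left _ hu, huv.mono hj⟩
  tauto

lemma IsLiveState.next {G : ICNetwork V} {A : Finset (V × V)} (hA : A ⊆ G.edges)
    {Sr S : Finset V} {t : ℕ} {s : DiffusionState V} (h : IsLiveState A Sr S t s) :
    IsLiveState A Sr S (t + 1) (nextState s (A ∩ stepEdges G s)) := by
  set nR := ((A ∩ stepEdges G s).filter fun e => e.1 ∈ s.rumor).image Prod.snd with hnR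
  set nP := ((A ∩ stepEdges G s).filter fun e => e.1 ∈ s.positive).image Prod.snd with hnP
  have memR : ∀ v, v ∈ nR ↔ ∃ u, (u, v) ∈ A ∧ u ∈ s.newlyActive ∧
      v ∉ s.rumor ∪ s.positive ∧ u ∈ s.rumor := by
    intro v
    simp only [hnR, Finset.mem_image, Finset.mem_filter, Finset.mem_inter, stepEdges]
    constructor
    · rintro ⟨⟨u, w⟩, ⟨⟨h1, -, h2, h3⟩, h4⟩, rfl⟩
      exact ⟨u, h1, h2, h3, h4⟩
    · rintro ⟨u, h1, h2, h3, h4⟩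
      exact ⟨(u, v), ⟨⟨h1, hA h1, h2, h3⟩, h4⟩, rfl⟩
  have memP : ∀ v, v ∈ nP ↔ ∃ u, (u, v) ∈ A ∧ u ∈ s.newlyActive ∧
      v ∉ s.rumor ∪ s.positive ∧ u ∈ s.positive := by
    intro v
    simp only [hnP, Finset.mem_image, Finset.mem_filter, Finset.mem_inter, stepEdges]
    constructor
    · rintro ⟨⟨u, w⟩, ⟨⟨h1, -, h2, h3⟩, h4⟩, rfl⟩
      exact ⟨u, h1, h2, h3, h4⟩
    · rintro ⟨u, h1, h2, h3, h4⟩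
      exact ⟨(u, v), ⟨⟨h1, hA h1, h2, h3⟩, h4⟩, rfl⟩
  have eR : (nextState s (A ∩ stepEdges G s)).rumor = s.rumor ∪ nR := rfl
  have eP : (nextState s (A ∩ stepEdges G s)).positive = s.positive ∪ (nP \ nR) := rfl
  have eN : (nextState s (A ∩ stepEdges G s)).newlyActive = nR ∪ (nP \ nR) := rfl
  have hact := h.active_iff
  -- a predecessor of a node that is reached at time `t + 1` exactly
  have newly_of_edge : ∀ x ∈ Sr ∪ S, ∀ u v, v ∉ s.rumor ∪ s.positive → Reach A t x u →
      (u, v) ∈ A → u ∈ s.newlyActive := by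
    intro x hx u v hv hxu huv
    refine (h.newly u).2 ⟨⟨x, hx, hxu⟩, ?_⟩
    rintro i hi ⟨y, hy, hyu⟩
    have hyv : Reach A (i + 1) y v := Or.inr ⟨u, hyu, huv⟩
    exact hv ((hact v).2 ⟨y, hy, hyv.mono hi⟩)
  have act_succ : ∀ u v, (u, v) ∈ A → u ∈ s.newlyActive → ∃ x ∈ Sr ∪ S, Reach A (t + 1) x v := by
    intro u v huv hu
    obtain ⟨⟨x, hx, hxu⟩, -⟩ := (h.newly u).1 hu
    exact ⟨x, hx, Or.inr ⟨u, hxu, huv⟩⟩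
  have rumor' : ∀ v, v ∈ s.rumor ∪ nR ↔ LostBy A Sr S (t + 1) v := by
    intro v
    rw [Finset.mem_union, memR]
    constructor
    · rintro (hv | ⟨u, huv, hu, hv, hur⟩)
      · obtain ⟨j, hj, h1⟩ := (h.rumor v).1 hv
        exact ⟨j, hj.trans t.le_succ, h1⟩
      · obtain ⟨j, hj, ⟨x, hx, hxu⟩, -⟩ := (h.rumor u).1 hur
        refine ⟨t + 1, le_rfl, ⟨x, hx, Or.inr ⟨u, hxu.mono hj, huv⟩⟩, ?_⟩
        intro i hi y hy hyv
        exact hv ((hact v).2 ⟨y, Finset.mem_union_right _ hy, hyv.mono (Nat.lt_succ_iff.1 hi)⟩)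
    · rintro ⟨j, hj, ⟨x, hx, hxv⟩, h1⟩
      rcases Nat.lt_or_ge t j with hlt | hle
      · obtain rfl : j = t + 1 := le_antisymm hj hlt
        by_cases hr : ∃ y ∈ Sr, Reach A t y v
        · exact Or.inl ((h.rumor v).2 ⟨t, le_rfl, hr, fun i hi => h1 i (hi.trans t.lt_succ_self)⟩)
        · right
          rcases hxv with hxv | ⟨u, hxu, huv⟩
          · exact absurd ⟨x, hx, hxv⟩ hr
          · have hv : v ∉ s.rumor ∪ s.positive := by
              rw [hact]
              rintro ⟨y, hy, hyv⟩
              rcases Finset.mem_union.1 hy with hy | hy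
              · exact hr ⟨y, hy, hyv⟩
              · exact h1 t t.lt_succ_self y hy hyv
            refine ⟨u, huv, newly_of_edge x (Finset.mem_union_left _ hx) u v hv hxu huv, hv, ?_⟩
            refine (h.rumor u).2 ⟨t, le_rfl, ⟨x, hx, hxu⟩, fun i hi y hy hyu => ?_⟩
            exact h1 (i + 1) (Nat.succ_lt_succ hi) y hy (Or.inr ⟨u, hyu, huv⟩)
      · exact Or.inl ((h.rumor v).2 ⟨j, hle, ⟨x, hx, hxv⟩, h1⟩)
  have newly_iff : ∀ v, v ∈ nR ∪ (nP \ nR) ↔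
      v ∉ s.rumor ∪ s.positive ∧ ∃ u ∈ Sr ∪ S, Reach A (t + 1) u v := by
    intro v
    rw [Finset.union_sdiff_self_eq_union, Finset.mem_union, memR, memP]
    constructor
    · rintro (⟨u, h1, h2, h3, -⟩ | ⟨u, h1, h2, h3, -⟩) <;> exact ⟨h3, act_succ u v h1 h2⟩
    · rintro ⟨hv, x, hx, hxv | ⟨u, hxu, huv⟩⟩
      · exact absurd ((hact v).2 ⟨x, hx, hxv⟩) hv
      · have h1 := newly_of_edge x hx u v hv hxu huv
        rcases Finset.mem_union.1 ((hact u).2 ⟨x, hx, hxu⟩) with h2 | h2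
        · exact Or.inl ⟨u, huv, h1, hv, h2⟩
        · exact Or.inr ⟨u, huv, h1, hv, h2⟩
  have nR_inactive : ∀ v ∈ nR, v ∉ s.rumor ∪ s.positive := fun v hv => by
    obtain ⟨u, -, -, h3, -⟩ := (memR v).1 hv
    exact h3
  refine ⟨?_, ?_, ?_⟩
  · intro v
    rw [eR, rumor']
  · intro v
    rw [eP, eR]
    have h1 := newly_iff v
    have h2 := hact v
    have h3 := nR_inactive v
    have h4 := h.positive v
    have h5 : (∃ u ∈ Sr ∪ S, Reach A t u v) → ∃ u ∈ Sr ∪ S, Reach A (t + 1) u v :=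
      fun ⟨x, hx, hxv⟩ => ⟨x, hx, Or.inl hxv⟩
    rw [← h2] at h4 h5
    rw [Finset.mem_union, Finset.mem_union, Finset.mem_sdiff]
    rw [Finset.mem_union, Finset.mem_sdiff] at h1
    rw [Finset.mem_union] at h1 h3 h4 h5
    generalize (∃ u ∈ Sr ∪ S, Reach A (t + 1) u v) = Y at *
    clear_value nR nP
    clear h2 memR memP eR eP eN hact newly_of_edge act_succ rumor' newly_iff nR_inactive h
    tauto
  · intro v
    rw [eN, newly_iff, hact]
    constructor
    · rintro ⟨h1, h2⟩
      exact ⟨h2, fun i hi ⟨x, hx, hxv⟩ => h1 ⟨x, hx, hxv.mono (Nat.lt_succ_iff.1 hi)⟩⟩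
    · rintro ⟨h1, h2⟩
      exact ⟨h2 t t.lt_succ_self, h1⟩

lemma IsLiveState.liveRun {G : ICNetwork V} {A : Finset (V × V)} (hA : A ⊆ G.edges)
    {Sr S : Finset V} {i : ℕ} {s : DiffusionState V} (h : IsLiveState A Sr S i s) (t : ℕ) :
    IsLiveState A Sr S (i + t) (liveRun G t s A) := by
  induction t generalizing i s with
  | zero => exact h
  | succ t ih =>
    rw [← add_assoc, add_right_comm]
    exact ih (h.next hA)

/-- The edges tested in one round of the reverse sampling. -/
def roundEdges (G : ICNetwork V) (Vs : Finset V) (Et Ef : Finset (V × V)) : Finset (V × V) :=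
  G.edges.filter fun e => e.2 ∈ Vs ∧ e.1 ∉ Vs ∧ e ∉ Et ∪ Ef

/-- The reverse sampling along a fixed set of live edges. -/
def liveLoop (G : ICNetwork V) (Sr : Finset V) : ℕ → Finset V → Finset V → Finset (V × V) →
    Finset (V × V) → Finset (V × V) → RTuple V
  | 0, Vs, _, Et, Ef, _ => ⟨Vs, Et, Ef, false⟩
  | r + 1, Vs, V1, Et, Ef, A =>
    if V1 = ∅ then ⟨Vs, Et, Ef, false⟩
    else if (V1 ∩ Sr).Nonempty then ⟨Vs, Et, Ef, true⟩
    else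
      let D := roundEdges G (Vs ∪ V1) Et Ef
      liveLoop G Sr r (Vs ∪ V1) ((A ∩ D).image Prod.fst) (Et ∪ A ∩ D) (Ef ∪ (D \ (A ∩ D))) A

lemma liveLoop_congr (G : ICNetwork V) (Sr : Finset V) {r : ℕ} {Vs V1 : Finset V}
    {Et Ef A B : Finset (V × V)} (h : ∀ e ∉ Et ∪ Ef, (e ∈ A ↔ e ∈ B)) :
    liveLoop G Sr r Vs V1 Et Ef A = liveLoop G Sr r Vs V1 Et Ef B := by
  induction r generalizing Vs V1 Et Ef with
  | zero => rfl
  | succ r ih =>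
    have h1 : A ∩ roundEdges G (Vs ∪ V1) Et Ef = B ∩ roundEdges G (Vs ∪ V1) Et Ef := by
      ext e
      have := h e
      simp only [Finset.mem_inter, roundEdges, Finset.mem_filter]
      tauto
    simp only [liveLoop, h1]
    split_ifs
    · rfl
    · rfl
    · refine ih fun e he => h e ?_
      simp only [Finset.mem_union] at he ⊢
      tauto

lemma rTupleLoop_eq [Fintype V] (G : ICNetwork V) (Sr : Finset V) (r : ℕ) (Vs V1 : Finset V)
    (Et Ef : Finset (V × V)) :
    rTupleLoop G Sr r Vs V1 Et Ef = (coins G.prob G.prob_le_one G.edges).bind fun A =>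
      PMF.pure (liveLoop G Sr r Vs V1 Et Ef A) := by
  induction r generalizing Vs V1 Et Ef with
  | zero => simp [rTupleLoop, liveLoop, PMF.bind_const]
  | succ r ih =>
    by_cases h1 : V1 = ∅
    · simp [rTupleLoop, liveLoop, h1, PMF.bind_const]
    by_cases h2 : (V1 ∩ Sr).Nonempty
    · simp [rTupleLoop, liveLoop, h1, h2, PMF.bind_const]
    set D := roundEdges G (Vs ∪ V1) Et Ef with hD
    have h3 : rTupleLoop G Sr (r + 1) Vs V1 Et Ef =
        (coins G.prob G.prob_le_one D).bind fun A =>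
          rTupleLoop G Sr r (Vs ∪ V1) (A.image Prod.fst) (Et ∪ A) (Ef ∪ (D \ A)) := by
      rw [rTupleLoop, if_neg h1, if_neg h2]
      rfl
    have h4 := coins_bind_deferred G.prob G.prob_le_one (D := D) (E := G.edges)
      (Finset.filter_subset _ _) (fun A B => PMF.pure (liveLoop G Sr r (Vs ∪ V1)
        (A.image Prod.fst) (Et ∪ A) (Ef ∪ (D \ A)) B)) ?_
    · rw [h3]
      simp only [ih]
      rw [← h4]
      simp only [liveLoop, if_neg h1, if_neg h2, ← hD]
    · intro A hA B C hBC
      rw [liveLoop_congr]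
      intro e he
      have h5 := Finset.ext_iff.1 hBC e
      simp only [Finset.mem_union, Finset.mem_sdiff] at he h5
      tauto

lemma cover_liveLoop_eq_zero_iff [Fintype V] {G : ICNetwork V} {A : Finset (V × V)} (hA : A ⊆ G.edges)
    (Sr S : Finset V) (v : V) {b r : ℕ} (hbr : b + r = Fintype.card V + 1) {Vs V1 : Finset V}
    {Et Ef : Finset (V × V)} (hVs : ∀ u, u ∈ Vs ↔ ∃ i < r, Reach A i u v)
    (hV1 : ∀ u, u ∈ V1 ↔ Reach A r u v ∧ ∀ i < r, ¬ Reach A i u v)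
    (hSr : ∀ u ∈ Vs, u ∉ Sr) (hE : ∀ e ∈ Et ∪ Ef, e.2 ∈ Vs) (hcard : r ≤ Vs.card) :
    cover S (liveLoop G Sr b Vs V1 Et Ef A) = 0 ↔ LostBy A Sr S (Fintype.card V) v := by
  induction b generalizing r Vs V1 Et Ef with
  | zero =>
    have := Finset.card_le_univ Vs
    omega
  | succ b ih =>
    by_cases h1 : V1 = ∅
    · have hclosed : ∀ j u, Reach A j u v → u ∈ Vs := by
        have hr : ∀ u, Reach A r u v → u ∈ Vs := by
          intro u hu
          by_contra hu'
          have : u ∈ V1 := (hV1 u).2 ⟨hu, fun i hi h => hu' ((hVs u).2 ⟨i, hi, h⟩)⟩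
          simp [h1] at this
        intro j
        induction j with
        | zero => exact fun u hu => hr u (hu.mono (Nat.zero_le _))
        | succ j ihj =>
          intro u hu
          rcases reach_succ_iff_head.1 hu with hu | ⟨w, huw, hw⟩
          · exact ihj u hu
          · obtain ⟨i, hi, hwi⟩ := (hVs w).1 (ihj w hw)
            exact hr u ((reach_succ_iff_head.2 (Or.inr ⟨w, huw, hwi⟩)).mono hi)
      simp only [liveLoop, h1, if_true, cover, or_true, one_ne_zero, false_iff]
      rintro ⟨j, -, ⟨u, hu, huv⟩, -⟩
      exact hSr u (hclosed j u huv) hu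
    by_cases h2 : (V1 ∩ Sr).Nonempty
    · simp only [liveLoop, h1, h2, if_true, if_false, cover, Bool.true_eq_false, or_false]
      rw [ite_eq_right_iff]
      simp only [one_ne_zero, imp_false, Finset.not_nonempty_iff_eq_empty]
      constructor
      · intro h3
        obtain ⟨u, hu⟩ := h2
        rw [Finset.mem_inter] at hu
        refine ⟨r, by omega, ⟨u, hu.2, ((hV1 u).1 hu.1).1⟩, fun i hi w hw hwv => ?_⟩
        have : w ∈ S ∩ Vs := Finset.mem_inter.2 ⟨hw, (hVs w).2 ⟨i, hi, hwv⟩⟩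
        simp [h3] at this
      · rintro ⟨j, -, ⟨u, hu, huv⟩, h3⟩
        have hrj : r ≤ j := by
          by_contra hj
          exact hSr u ((hVs u).2 ⟨j, not_le.1 hj, huv⟩) hu
        rw [Finset.eq_empty_iff_forall_notMem]
        intro w hw
        rw [Finset.mem_inter, hVs] at hw
        obtain ⟨hw, i, hi, hwv⟩ := hw
        exact h3 i (hi.trans_le hrj) w hw hwv
    rw [liveLoop, if_neg h1, if_neg h2]
    have hVs' : ∀ u, u ∈ Vs ∪ V1 ↔ ∃ i < r + 1, Reach A i u v := by
      intro u
      rw [Finset.mem_union, hVs, hV1]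
      constructor
      · rintro (⟨i, hi, h⟩ | ⟨h, -⟩)
        · exact ⟨i, by omega, h⟩
        · exact ⟨r, by omega, h⟩
      · rintro ⟨i, hi, h⟩
        by_cases h3 : ∃ i < r, Reach A i u v
        · exact Or.inl h3
        · exact Or.inr ⟨h.mono (by omega), fun i hi h => h3 ⟨i, hi, h⟩⟩
    refine ih (r := r + 1) (by omega) hVs' ?_ ?_ ?_ ?_
    · intro u
      simp only [Finset.mem_image, Finset.mem_inter, roundEdges, Finset.mem_filter]
      constructor
      · rintro ⟨⟨u', w⟩, ⟨huw, -, hw, hu, -⟩, rfl⟩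
        obtain ⟨i, hi, hwv⟩ := (hVs' w).1 hw
        exact ⟨(reach_succ_iff_head.2 (Or.inr ⟨w, huw, hwv⟩)).mono hi,
          fun i hi h => hu ((hVs' _).2 ⟨i, hi, h⟩)⟩
      · rintro ⟨hu, hu'⟩
        rcases reach_succ_iff_head.1 hu with hu | ⟨w, huw, hw⟩
        · exact absurd hu (hu' r (by omega))
        · refine ⟨(u, w), ⟨huw, hA huw, (hVs' w).2 ⟨r, by omega, hw⟩, ?_, ?_⟩, rfl⟩
          · intro h
            obtain ⟨i, hi, h⟩ := (hVs' _).1 h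
            exact hu' i hi h
          · intro h
            obtain ⟨i, hi, h⟩ := (hVs _).1 (hE _ h)
            exact hu' (i + 1) (by omega) (reach_succ_iff_head.2 (Or.inr ⟨w, huw, h⟩))
    · intro u hu
      rcases Finset.mem_union.1 hu with hu | hu
      · exact hSr u hu
      · intro h
        exact h2 ⟨u, Finset.mem_inter.2 ⟨hu, h⟩⟩
    · intro e he
      have h3 : e ∈ Et ∪ Ef ∨ e ∈ roundEdges G (Vs ∪ V1) Et Ef := by
        simp only [Finset.mem_union, Finset.mem_inter, Finset.mem_sdiff] at he ⊢
        tauto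
      rcases h3 with h3 | h3
      · exact Finset.mem_union_left _ (hE e h3)
      · exact (Finset.mem_filter.1 h3).2.1
    · have h3 : Disjoint Vs V1 := by
        rw [Finset.disjoint_left]
        intro u hu hu'
        obtain ⟨i, hi, h⟩ := (hVs u).1 hu
        exact ((hV1 u).1 hu').2 i hi h
      rw [Finset.card_union_of_disjoint h3]
      have := Finset.card_pos.2 (Finset.nonempty_iff_ne_empty.2 h1)
      omega

variable [Fintype V]

/-- The probability that `v` is not activated by the rumor. -/
noncomputable def survival (G : ICNetwork V) (Sr S : Finset V) (v : V) : ℝ≥0∞ :=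
  open Classical in
  expect (coins G.prob G.prob_le_one G.edges) fun A =>
    if LostBy A Sr S (Fintype.card V) v then 0 else 1

lemma survival_le_one (G : ICNetwork V) (Sr S : Finset V) (v : V) : survival G Sr S v ≤ 1 := by
  classical
  rw [← expect_const (coins G.prob G.prob_le_one G.edges) 1]
  refine expect_mono fun A _ => ?_
  split_ifs <;> simp

lemma survival_eq_one (G : ICNetwork V) {Sr S : Finset V} {v : V} (hv : v ∉ Sr) (hS : v ∈ S) :
    survival G Sr S v = 1 := by
  classical
  rw [← expect_const (coins G.prob G.prob_le_one G.edges) 1]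
  refine expect_congr fun A _ => if_neg ?_
  rintro ⟨j, -, ⟨u, hu, huv⟩, h⟩
  rcases Nat.eq_zero_or_pos j with rfl | hj
  · obtain rfl : u = v := huv
    exact hv hu
  · exact h 0 hj v hS rfl

lemma ofReal_blocked (G : ICNetwork V) (Sr S : Finset V) :
    ENNReal.ofReal (blocked G Sr S) = ∑ v, survival G Sr S v := by
  classical
  have h1 : ENNReal.ofReal (blocked G Sr S) =
      expect (finalRumor G Sr S) fun A => ((Aᶜ).card : ℝ≥0∞) := by
    unfold blocked expect
    rw [ENNReal.ofReal_sum_of_nonneg fun A _ => by positivity, tsum_fintype]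
    refine Finset.sum_congr rfl fun A _ => ?_
    rw [ENNReal.ofReal_mul ENNReal.toReal_nonneg, ENNReal.ofReal_toReal (PMF.apply_ne_top _ _),
      ENNReal.ofReal_natCast]
  rw [h1, finalRumor, expect_map, diffusionRun_eq, expect_bind]
  · simp only [expect_pure, survival]
    rw [← expect_sum]
    refine expect_congr fun A hA => ?_
    have h2 := (isLiveState_initialState A Sr S).liveRun
      (subset_of_mem_support_coins _ _ hA) (Fintype.card V)
    rw [zero_add] at h2
    have h3 : (liveRun G (Fintype.card V) (initialState Sr S) A).rumorᶜ =
        Finset.univ.filter fun v => ¬ LostBy A Sr S (Fintype.card V) v := by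
      ext v
      simp [h2.rumor v]
    rw [h3, Finset.card_filter]
    push_cast
    refine Finset.sum_congr rfl fun v _ => ?_
    split_ifs <;> simp_all
  · intro v hv
    simp only [initialState, Finset.mem_union, Finset.mem_sdiff] at hv ⊢
    tauto

lemma expect_cover_rTupleOf (G : ICNetwork V) (Sr S : Finset V) (v : V) :
    (expect (rTupleOf G Sr v) fun T => (cover S T : ℝ≥0∞)) = survival G Sr S v := by
  classical
  rw [rTupleOf, rTupleLoop_eq, expect_bind]
  simp only [expect_pure, survival]
  refine expect_congr fun A hA => ?_
  have h1 := cover_liveLoop_eq_zero_iff (subset_of_mem_support_coins _ _ hA) Sr S v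
    (b := Fintype.card V + 1) (r := 0) rfl (Vs := ∅) (V1 := {v}) (Et := ∅) (Ef := ∅)
    (by simp) (by simp [Reach]) (by simp) (by simp) (by simp)
  split_ifs with h2
  · simp [h1.2 h2]
  · have h3 := mt h1.1 h2
    unfold cover at h3 ⊢
    split_ifs at h3 ⊢ with h4
    · simp
    · exact absurd rfl h3

lemma expect_cover_randomRTuple [Nonempty V] (G : ICNetwork V) (Sr S : Finset V) :
    (expect (randomRTuple G Sr) fun T => (cover S T : ℝ≥0∞)) =
      ENNReal.ofReal (blocked G Sr S / Fintype.card V) := by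
  rw [randomRTuple, expect_bind]
  simp only [expect_cover_rTupleOf]
  rw [ENNReal.ofReal_div_of_pos (by exact_mod_cast Fintype.card_pos), ofReal_blocked, expect,
    tsum_fintype]
  simp only [PMF.uniformOfFintype_apply]
  rw [← Finset.mul_sum, ENNReal.ofReal_natCast, mul_comm, div_eq_mul_inv]

lemma blocked_nonneg (G : ICNetwork V) (Sr S : Finset V) : 0 ≤ blocked G Sr S :=
  Finset.sum_nonneg fun _ _ => by positivity

lemma blocked_le_card (G : ICNetwork V) (Sr S : Finset V) :
    blocked G Sr S ≤ Fintype.card V := by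
  have h : ENNReal.ofReal (blocked G Sr S) ≤ ENNReal.ofReal (Fintype.card V) := by
    rw [ofReal_blocked, ENNReal.ofReal_natCast]
    calc _ ≤ ∑ _v : V, (1 : ℝ≥0∞) := Finset.sum_le_sum fun v _ => survival_le_one G Sr S v
      _ = _ := by simp
  exact (ENNReal.ofReal_le_ofReal_iff (by positivity)).1 h

lemma one_le_blocked (G : ICNetwork V) {Sr S : Finset V} {v : V} (hv : v ∉ Sr) (hS : v ∈ S) :
    1 ≤ blocked G Sr S := by
  have h : ENNReal.ofReal 1 ≤ ENNReal.ofReal (blocked G Sr S) := by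
    rw [ofReal_blocked, ENNReal.ofReal_one, ← survival_eq_one G hv hS]
    exact Finset.single_le_sum (f := survival G Sr S) (fun _ _ => zero_le) (Finset.mem_univ v)
  exact (ENNReal.ofReal_le_ofReal_iff (blocked_nonneg _ _ _)).1 h

lemma blocked_le_OPT (G : ICNetwork V) (Sr : Finset V) {S : Finset V} {k : ℕ} (hS : S.card ≤ k) :
    blocked G Sr S ≤ OPT G Sr k :=
  Finset.le_sup' (blocked G Sr) (by simpa using hS)

lemma exists_blocked_eq_OPT (G : ICNetwork V) (Sr : Finset V) (k : ℕ) :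
    ∃ S : Finset V, S.card ≤ k ∧ OPT G Sr k = blocked G Sr S := by
  obtain ⟨S, hS, h⟩ := Finset.exists_mem_eq_sup' (s := Finset.univ.filter
    fun S : Finset V => S.card ≤ k) ⟨∅, by simp⟩ (blocked G Sr)
  exact ⟨S, by simpa using hS, h⟩

end LiveEdge

/-! ### The approximation ratio of the greedy selection -/

section Greedy

variable {V : Type*} [DecidableEq V]

/-- The number of sets in the list `L` that meet `S`. -/
def hits (S : Finset V) (L : List (Finset V)) : ℕ :=
  L.countP fun A => decide (S ∩ A).Nonempty

lemma hits_eq_coverCount_add {S : Finset V} {v : V} (hv : v ∈ S) (L : List (Finset V)) :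
    hits S L = coverCount L v + hits S (L.filter fun A => decide (v ∉ A)) := by
  induction L with
  | nil => rfl
  | cons A L ih =>
    simp only [hits, coverCount, List.countP_cons, List.filter_cons] at ih ⊢
    by_cases h : v ∈ A
    · have h2 : (S ∩ A).Nonempty := ⟨v, Finset.mem_inter.2 ⟨hv, h⟩⟩
      simp only [h, h2, decide_true, not_true_eq_false, decide_false, if_true] at ih ⊢
      simp only [Bool.false_eq_true, if_false]
      omega
    · simp only [h, not_false_eq_true, decide_true, decide_false, if_true, List.countP_cons] at ih ⊢
      simp only [Bool.false_eq_true, if_false]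
      omega

lemma hits_le_coverCount_add (S : Finset V) (v : V) (L : List (Finset V)) :
    hits S L ≤ coverCount L v + hits S (L.filter fun A => decide (v ∉ A)) := by
  refine le_trans ?_ (hits_eq_coverCount_add (Finset.mem_insert_self v S) L).le |>.trans ?_
  · refine List.countP_mono_left fun A _ h => ?_
    simp only [decide_eq_true_eq] at h ⊢
    exact h.mono (Finset.inter_subset_inter_right (Finset.subset_insert v S))
  · refine Nat.add_le_add_left (le_of_eq ?_) _
    refine List.countP_congr fun A hA => ?_
    have hv : v ∉ A := by simpa using (List.mem_filter.1 hA).2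
    rw [Finset.insert_inter_of_notMem hv]

lemma hits_le_sum_coverCount (S : Finset V) (L : List (Finset V)) :
    hits S L ≤ ∑ u ∈ S, coverCount L u := by
  induction L with
  | nil => simp [hits]
  | cons A L ih =>
    simp only [hits, coverCount, List.countP_cons, Finset.sum_add_distrib] at ih ⊢
    refine add_le_add ih ?_
    split_ifs with h
    · obtain ⟨u, hu⟩ : (S ∩ A).Nonempty := by simpa using h
      rw [Finset.mem_inter] at hu
      refine le_trans ?_ (Finset.single_le_sum (fun _ _ => Nat.zero_le _) hu.1)
      simp [hu.2]
    · exact Nat.zero_le _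

lemma subset_greedy (pick : Finset V → List (Finset V) → V) (r : ℕ) (S : Finset V)
    (L : List (Finset V)) : S ⊆ greedy pick r S L := by
  induction r generalizing S L with
  | zero => exact subset_rfl
  | succ r ih => exact (Finset.subset_insert _ _).trans (ih _ _)

lemma card_greedy_le (pick : Finset V → List (Finset V) → V) (r : ℕ) (S : Finset V)
    (L : List (Finset V)) : (greedy pick r S L).card ≤ S.card + r := by
  induction r generalizing S L with
  | zero => exact le_rfl
  | succ r ih =>
    have h1 := ih (insert (pick S L) S) (L.filter fun A => decide (pick S L ∉ A))
    have h2 := Finset.card_insert_le (pick S L) S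
    rw [greedy]
    omega

lemma hits_greedy_ge {pick : Finset V → List (Finset V) → V} (hpick : IsGreedyRule pick)
    {k : ℕ} (hk : 1 ≤ k) {S₀ : Finset V} (hS₀ : S₀.card ≤ k) (r : ℕ) (S : Finset V)
    (L : List (Finset V)) :
    (1 - (1 - 1 / (k : ℝ)) ^ r) * hits S₀ L ≤ hits (greedy pick r S L) L := by
  have hk0 : (0 : ℝ) < k := by exact_mod_cast hk
  have hρ0 : 0 ≤ 1 - 1 / (k : ℝ) := by
    rw [sub_nonneg, div_le_one hk0]
    exact_mod_cast hk
  have hρ1 : 1 - 1 / (k : ℝ) ≤ 1 := by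
    have : 0 ≤ 1 / (k : ℝ) := by positivity
    linarith
  induction r generalizing S L with
  | zero => simp
  | succ r ih =>
    rw [greedy]
    set v := pick S L with hv
    set L' := L.filter fun A => decide (v ∉ A) with hL'
    have h1 := ih (insert v S) L'
    have h2 : (hits (greedy pick r (insert v S) L') L : ℝ) =
        coverCount L v + hits (greedy pick r (insert v S) L') L' := by
      exact_mod_cast hits_eq_coverCount_add
        (subset_greedy pick r _ L' (Finset.mem_insert_self v S)) L
    have h3 : (hits S₀ L : ℝ) ≤ coverCount L v + hits S₀ L' := by
      exact_mod_cast hits_le_coverCount_add S₀ v L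
    have h4 : (hits S₀ L : ℝ) ≤ k * coverCount L v := by
      have : hits S₀ L ≤ k * coverCount L v :=
        calc hits S₀ L ≤ ∑ u ∈ S₀, coverCount L u := hits_le_sum_coverCount S₀ L
          _ ≤ ∑ _u ∈ S₀, coverCount L v := Finset.sum_le_sum fun u _ => hpick S L u
          _ = S₀.card * coverCount L v := by simp
          _ ≤ _ := Nat.mul_le_mul_right _ hS₀
      exact_mod_cast this
    have h5 : 1 / (k : ℝ) * hits S₀ L ≤ coverCount L v := by
      rw [one_div, inv_mul_le_iff₀ hk0]
      exact h4
    have h6 : 0 ≤ (1 - 1 / (k : ℝ)) ^ r := pow_nonneg hρ0 r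
    have h7 : (1 - 1 / (k : ℝ)) ^ r ≤ 1 := pow_le_one₀ hρ0 hρ1
    rw [h2, pow_succ]
    have h8 := mul_le_mul_of_nonneg_left h3 (sub_nonneg.2 h7)
    have h9 := mul_le_mul_of_nonneg_left h5 h6
    nlinarith

lemma cover_mono {S S' : Finset V} (h : S ⊆ S') (T : RTuple V) : cover S T ≤ cover S' T := by
  unfold cover
  split_ifs with h1 h2
  · exact le_rfl
  · exact absurd (h1.imp_left fun h3 => h3.mono (Finset.inter_subset_inter_right h)) h2
  · exact Nat.zero_le _
  · exact le_rfl

lemma cover_le_one (S : Finset V) (T : RTuple V) : cover S T ≤ 1 := by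
  unfold cover
  split_ifs <;> simp

lemma totalCover_mono {S S' : Finset V} (h : S ⊆ S') (R : List (RTuple V)) :
    totalCover S R ≤ totalCover S' R :=
  List.sum_le_sum fun T _ => cover_mono h T

lemma totalCover_le_length (S : Finset V) (R : List (RTuple V)) :
    totalCover S R ≤ R.length := by
  induction R with
  | nil => rfl
  | cons T R ih =>
    have := cover_le_one S T
    simp only [totalCover, List.map_cons, List.sum_cons, List.length_cons] at ih ⊢
    omega

lemma totalCover_cons (S : Finset V) (T : RTuple V) (R : List (RTuple V)) :
    totalCover S (T :: R) = cover S T + totalCover S R := by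
  simp [totalCover]

variable [Fintype V]

lemma totalCover_eq_hits {S : Finset V} (hS : S.Nonempty) (R : List (RTuple V)) :
    totalCover S R =
      hits S (R.map fun T => if T.hit = true then T.nodes else Finset.univ) := by
  induction R with
  | nil => rfl
  | cons T R ih =>
    rw [totalCover_cons, ih]
    simp only [hits, List.map_cons, List.countP_cons]
    rw [add_comm]
    congr 1
    cases h : T.hit <;> simp [cover, h, hS]

lemma card_nodeSelection_le (pick : Finset V → List (Finset V) → V) (R : List (RTuple V))
    (k : ℕ) : (nodeSelection pick R k).card ≤ k := by
  simpa [nodeSelection] using card_greedy_le pick k ∅ _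

lemma nodeSelection_nonempty (pick : Finset V → List (Finset V) → V) (R : List (RTuple V))
    {k : ℕ} (hk : 1 ≤ k) : (nodeSelection pick R k).Nonempty := by
  obtain ⟨k, rfl⟩ := Nat.exists_eq_add_of_le' hk
  exact ⟨_, subset_greedy pick k _ _ (Finset.mem_insert_self _ _)⟩

lemma totalCover_nodeSelection_ge {pick : Finset V → List (Finset V) → V}
    (hpick : IsGreedyRule pick) {k : ℕ} (hk : 1 ≤ k) (hkn : k ≤ Fintype.card V) {S : Finset V}
    (hS : S.card ≤ k) (R : List (RTuple V)) :
    (1 - 1 / Real.exp 1) * totalCover S R ≤ totalCover (nodeSelection pick R k) R := by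
  obtain ⟨S', hSS', hS'⟩ := Finset.exists_superset_card_eq hS hkn
  have hS'n : S'.Nonempty := Finset.card_pos.1 (by omega)
  have hk0 : (0 : ℝ) < k := by exact_mod_cast hk
  have h1 := hits_greedy_ge hpick hk hS'.le k ∅
    (R.map fun T => if T.hit = true then T.nodes else Finset.univ)
  rw [← totalCover_eq_hits hS'n] at h1
  have h2 : totalCover (nodeSelection pick R k) R = _ :=
    totalCover_eq_hits (nodeSelection_nonempty pick R hk) R
  rw [nodeSelection] at h2
  rw [← h2] at h1
  have h3 : (1 - 1 / (k : ℝ)) ^ k ≤ 1 / Real.exp 1 := by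
    have h4 := Real.one_sub_div_pow_le_exp_neg (n := k) (t := 1) (by exact_mod_cast hk)
    rwa [Real.exp_neg, ← one_div] at h4
  refine le_trans ?_ h1
  have h4 : (totalCover S R : ℝ) ≤ totalCover S' R := by exact_mod_cast totalCover_mono hSS' R
  have h5 : 1 / Real.exp 1 ≤ 1 := by
    rw [div_le_one (Real.exp_pos 1)]
    exact Real.one_le_exp zero_le_one
  exact mul_le_mul (by linarith) h4 (by positivity) (by linarith)

end Greedy

/-! ### Concentration of the coverage -/

section Tails

lemma one_add_pow_le_two_mul_exp {x : ℝ} (hx : 0 ≤ x) {m : ℕ} (hm : 2 ≤ m) :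
    (1 + x) ^ m ≤ 2 * Real.exp ((m - 1) * x) := by
  obtain ⟨m, rfl⟩ := Nat.exists_eq_add_of_le' hm
  have h1 : (1 + x) ^ 2 ≤ 2 * Real.exp x := by
    have := Real.quadratic_le_exp_of_nonneg hx
    nlinarith
  have h2 : (1 + x) ^ m ≤ Real.exp (m * x) := by
    rw [Real.exp_nat_mul]
    exact pow_le_pow_left₀ (by linarith) (by linarith [Real.add_one_le_exp x]) m
  calc (1 + x) ^ (m + 2) = (1 + x) ^ m * (1 + x) ^ 2 := pow_add _ _ _
    _ ≤ Real.exp (m * x) * (2 * Real.exp x) := by gcongr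
    _ = 2 * Real.exp (((m + 2 : ℕ) - 1) * x) := by
        rw [mul_left_comm, ← Real.exp_add]
        push_cast
        ring_nf

/-- The upper tail with one sample more than the real number `l` of samples. -/
lemma upper_tail_le {δ p q l μ Λ : ℝ} {m : ℕ} (hδ : 0 < δ) (hp : 0 ≤ p) (hpq : p ≤ q)
    (hm : 2 ≤ m) (hml : m ≤ l + 1) (hμ : l * q ≤ μ) (hΛ : Λ * (2 + δ) ≤ μ * δ ^ 2) :
    (1 + δ) ^ (-((1 + δ) * μ)) * (1 + p * ((1 + δ) - 1)) ^ m ≤ 2 * Real.exp (-Λ) := by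
  have hq : 0 ≤ q := hp.trans hpq
  have hm1 : (2 : ℝ) ≤ m := by exact_mod_cast hm
  have hμ0 : 0 ≤ μ := le_trans (mul_nonneg (by linarith) hq) hμ
  have h1 : (1 + p * ((1 + δ) - 1)) ^ m ≤ 2 * Real.exp (μ * δ) := by
    calc (1 + p * ((1 + δ) - 1)) ^ m ≤ (1 + q * δ) ^ m := by
          refine pow_le_pow_left₀ (by nlinarith) ?_ m
          nlinarith
      _ ≤ 2 * Real.exp ((m - 1) * (q * δ)) :=
          one_add_pow_le_two_mul_exp (by positivity) hm
      _ ≤ 2 * Real.exp (μ * δ) := by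
          have : (m - 1) * (q * δ) ≤ μ * δ := by
            calc (m - 1) * (q * δ) ≤ l * (q * δ) := by gcongr; linarith
              _ = l * q * δ := by ring
              _ ≤ μ * δ := by gcongr
          gcongr
  have h2 : (1 + δ) ^ (-((1 + δ) * μ)) = Real.exp (-(Real.log (1 + δ) * ((1 + δ) * μ))) := by
    rw [Real.rpow_def_of_pos (by linarith)]
    ring_nf
  have h3 := Real.le_log_one_add_of_nonneg hδ.le
  rw [h2]
  calc _ ≤ Real.exp (-(Real.log (1 + δ) * ((1 + δ) * μ))) * (2 * Real.exp (μ * δ)) := by gcongr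
    _ = 2 * Real.exp (μ * δ - Real.log (1 + δ) * ((1 + δ) * μ)) := by
        rw [mul_left_comm, ← Real.exp_add]
        ring_nf
    _ ≤ 2 * Real.exp (-Λ) := by
        have h4 : 2 * δ / (δ + 2) * ((1 + δ) * μ) ≤ Real.log (1 + δ) * ((1 + δ) * μ) := by
          gcongr
        have h5 : Λ ≤ μ * δ ^ 2 / (2 + δ) := by rwa [le_div_iff₀ (by linarith)]
        have h6 : 2 * δ / (δ + 2) * ((1 + δ) * μ) = μ * δ + μ * δ ^ 2 / (2 + δ) := by
          field_simp
          ring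
        have : μ * δ - Real.log (1 + δ) * ((1 + δ) * μ) ≤ -Λ := by linarith
        gcongr

lemma log_one_add_le_sub {δ : ℝ} (hδ : 0 ≤ δ) :
    Real.log (1 + δ) ≤ δ - δ ^ 2 / (2 * (1 + δ)) := by
  have h1 : Real.log (1 + δ) ≤ Real.sinh (Real.log (1 + δ)) :=
    Real.self_le_sinh_iff.2 (Real.log_nonneg (by linarith))
  rw [Real.sinh_log (by linarith)] at h1
  refine h1.trans (le_of_eq ?_)
  field_simp
  ring

lemma lower_tail_le {δ q l Λ : ℝ} {m : ℕ} (hδ : 0 < δ) (hq : 0 ≤ q) (hq1 : q ≤ 1)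
    (hml : l ≤ m) (hΛ : Λ * (2 * (1 + δ) ^ 2) ≤ l * q * δ ^ 2) (hl : 0 ≤ l) :
    (1 + δ) ^ (l * q / (1 + δ)) * (1 + q * ((1 + δ)⁻¹ - 1)) ^ m ≤ Real.exp (-Λ) := by
  have hz : (1 + δ)⁻¹ - 1 = -(δ / (1 + δ)) := by
    field_simp
    ring
  have hz1 : δ / (1 + δ) ≤ 1 := by
    rw [div_le_one (by linarith)]
    linarith
  have hz0 : 0 ≤ δ / (1 + δ) := by positivity
  have h1 : (1 + q * ((1 + δ)⁻¹ - 1)) ^ m ≤ Real.exp (-(l * q * (δ / (1 + δ)))) := by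
    calc (1 + q * ((1 + δ)⁻¹ - 1)) ^ m ≤ Real.exp (-(q * (δ / (1 + δ)))) ^ m := by
          rw [hz]
          refine pow_le_pow_left₀ ?_ ?_ m
          · nlinarith
          · linarith [Real.add_one_le_exp (-(q * (δ / (1 + δ))))]
      _ = Real.exp (-(m * q * (δ / (1 + δ)))) := by
          rw [← Real.exp_nat_mul]
          ring_nf
      _ ≤ _ := by gcongr
  rw [Real.rpow_def_of_pos (by linarith)]
  calc _ ≤ Real.exp (Real.log (1 + δ) * (l * q / (1 + δ))) *
        Real.exp (-(l * q * (δ / (1 + δ)))) := by gcongr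
    _ = Real.exp (l * q / (1 + δ) * (Real.log (1 + δ) - δ)) := by
        rw [← Real.exp_add]
        ring_nf
    _ ≤ Real.exp (-Λ) := by
        have h2 : l * q / (1 + δ) * (Real.log (1 + δ) - δ) ≤
            l * q / (1 + δ) * (-(δ ^ 2 / (2 * (1 + δ)))) := by
          gcongr
          linarith [log_one_add_le_sub hδ.le]
        have h3 : l * q / (1 + δ) * (-(δ ^ 2 / (2 * (1 + δ)))) =
            -(l * q * δ ^ 2 / (2 * (1 + δ) ^ 2)) := by
          field_simp
        have h4 : Λ ≤ l * q * δ ^ 2 / (2 * (1 + δ) ^ 2) := by rwa [le_div_iff₀ (by positivity)]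
        have : l * q / (1 + δ) * (Real.log (1 + δ) - δ) ≤ -Λ := by linarith
        gcongr

variable {V : Type*} [Fintype V] [DecidableEq V] [Nonempty V]

lemma length_of_mem_support_generate {G : ICNetwork V} {Sr : Finset V} {c : ℕ}
    {R R' : List (RTuple V)} (h : R' ∈ (generate G Sr c R).support) :
    R'.length = c + R.length := by
  induction c generalizing R with
  | zero =>
    rw [generate, PMF.mem_support_pure_iff] at h
    simp [h]
  | succ c ih =>
    rw [generate, PMF.mem_support_bind_iff] at h
    obtain ⟨T, -, h⟩ := h
    rw [ih h, List.length_cons]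
    omega

lemma generate_add (G : ICNetwork V) (Sr : Finset V) (a b : ℕ) (R : List (RTuple V)) :
    generate G Sr (a + b) R = (generate G Sr a R).bind (generate G Sr b) := by
  induction a generalizing R with
  | zero => simp [generate]
  | succ a ih =>
    rw [Nat.add_right_comm]
    simp only [generate, ih, PMF.bind_bind]

lemma expect_pow_cover (G : ICNetwork V) (Sr S : Finset V) {z : ℝ} (hz : 0 ≤ z) :
    (expect (randomRTuple G Sr) fun T => ENNReal.ofReal z ^ cover S T) =
      ENNReal.ofReal (1 + blocked G Sr S / Fintype.card V * (z - 1)) := by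
  have hn : (0 : ℝ) < Fintype.card V := by exact_mod_cast Fintype.card_pos
  set p := blocked G Sr S / Fintype.card V with hp
  have hp0 : 0 ≤ p := div_nonneg (blocked_nonneg _ _ _) hn.le
  have hp1 : p ≤ 1 := (div_le_one hn).2 (blocked_le_card _ _ _)
  have h1 : (expect (randomRTuple G Sr) fun T => ENNReal.ofReal z ^ cover S T) +
      ENNReal.ofReal p = 1 + ENNReal.ofReal z * ENNReal.ofReal p := by
    rw [hp, ← expect_cover_randomRTuple, ← expect_mul_left, ← expect_add]
    conv_rhs => rw [← expect_const (randomRTuple G Sr) 1]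
    rw [← expect_add]
    refine expect_congr fun T _ => ?_
    rcases Nat.le_one_iff_eq_zero_or_eq_one.1 (cover_le_one S T) with h | h
    · simp [h]
    · simp [h, add_comm]
  have h2 : ENNReal.ofReal (1 + p * (z - 1)) + ENNReal.ofReal p =
      1 + ENNReal.ofReal z * ENNReal.ofReal p := by
    rw [← ENNReal.ofReal_add (by nlinarith) hp0, ← ENNReal.ofReal_mul hz, ← ENNReal.ofReal_one,
      ← ENNReal.ofReal_add zero_le_one (by positivity)]
    ring_nf
  exact (ENNReal.add_left_inj ENNReal.ofReal_ne_top).1 (h1.trans h2.symm)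

lemma expect_pow_totalCover (G : ICNetwork V) (Sr S : Finset V) (z : ℝ≥0∞) (c : ℕ)
    (R : List (RTuple V)) :
    (expect (generate G Sr c R) fun R' => z ^ totalCover S R') =
      z ^ totalCover S R * (expect (randomRTuple G Sr) fun T => z ^ cover S T) ^ c := by
  induction c generalizing R with
  | zero => simp [generate, expect_pure]
  | succ c ih =>
    rw [generate, expect_bind]
    simp only [ih, totalCover_cons, pow_add]
    rw [pow_one]
    calc _ = expect (randomRTuple G Sr) fun T => (z ^ totalCover S R *
          (expect (randomRTuple G Sr) fun T => z ^ cover S T) ^ c) * z ^ cover S T :=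
          expect_congr fun T _ => by ring
      _ = _ := by rw [expect_mul_left]; ring

lemma toOuterMeasure_generate_le (G : ICNetwork V) (Sr S : Finset V) {z w : ℝ} (hz : 0 ≤ z)
    (hw : 0 ≤ w) (c : ℕ) (s : Set (List (RTuple V)))
    (hs : ∀ R ∈ s, 1 ≤ w * z ^ totalCover S R) :
    (generate G Sr c []).toOuterMeasure s ≤
      ENNReal.ofReal (w * (1 + blocked G Sr S / Fintype.card V * (z - 1)) ^ c) := by
  have hn : (0 : ℝ) < Fintype.card V := by exact_mod_cast Fintype.card_pos
  have hp0 : 0 ≤ blocked G Sr S / Fintype.card V := div_nonneg (blocked_nonneg _ _ _) hn.le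
  have hp1 : blocked G Sr S / Fintype.card V ≤ 1 := (div_le_one hn).2 (blocked_le_card _ _ _)
  rw [toOuterMeasure_eq_expect]
  calc expect (generate G Sr c []) (s.indicator 1)
      ≤ expect (generate G Sr c []) fun R =>
          ENNReal.ofReal w * ENNReal.ofReal z ^ totalCover S R := by
        refine expect_mono fun R _ => ?_
        by_cases hR : R ∈ s
        · rw [Set.indicator_of_mem hR, ← ENNReal.ofReal_pow hz, ← ENNReal.ofReal_mul hw]
          exact ENNReal.one_le_ofReal.2 (hs R hR)
        · simp [hR]
    _ = _ := by
        rw [expect_mul_left, expect_pow_totalCover, expect_pow_cover G Sr S hz,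
          ENNReal.ofReal_mul hw, ENNReal.ofReal_pow (by nlinarith)]
        simp [totalCover]

lemma toOuterMeasure_generate_upper {G : ICNetwork V} {Sr S : Finset V} {δ q l M Λ : ℝ}
    (hδ : 0 < δ) (hl : 0 ≤ l) (hq : blocked G Sr S / Fintype.card V ≤ q)
    (hM : 1 < (1 + δ) * M) (hΛ : Λ * (2 + δ) ≤ M * δ ^ 2) :
    (generate G Sr (⌊l⌋ + 1).toNat []).toOuterMeasure
        {R | (1 + δ) * max (l * q) M ≤ totalCover S R} ≤ ENNReal.ofReal (2 * Real.exp (-Λ)) := by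
  have hn : (0 : ℝ) < Fintype.card V := by exact_mod_cast Fintype.card_pos
  set m := (⌊l⌋ + 1).toNat with hm
  have hmZ : (m : ℤ) = ⌊l⌋ + 1 := Int.toNat_of_nonneg (by have := Int.floor_nonneg.2 hl; omega)
  have hmR : (m : ℝ) = ⌊l⌋ + 1 := by exact_mod_cast hmZ
  rcases Nat.lt_or_ge m 2 with h2 | h2
  · refine le_of_eq_of_le ?_ zero_le
    rw [PMF.toOuterMeasure_apply_eq_zero_iff, Set.disjoint_left]
    intro R hR hR'
    have h3 := totalCover_le_length S R
    rw [length_of_mem_support_generate hR, List.length_nil] at h3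
    have h4 : (totalCover S R : ℝ) ≤ 1 := by exact_mod_cast (by omega : totalCover S R ≤ 1)
    have h5 : (1 + δ) * M ≤ (1 + δ) * max (l * q) M := by
      gcongr
      exact le_max_right _ _
    have h6 : (1 + δ) * max (l * q) M ≤ totalCover S R := hR'
    linarith
  · refine (toOuterMeasure_generate_le G Sr S (z := 1 + δ)
      (w := (1 + δ) ^ (-((1 + δ) * max (l * q) M))) (by linarith) (by positivity) m _ ?_).trans ?_
    · intro R hR
      rw [← Real.rpow_natCast, ← Real.rpow_add (by linarith)]
      refine Real.one_le_rpow (by linarith) ?_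
      have h6 : (1 + δ) * max (l * q) M ≤ totalCover S R := hR
      linarith
    · refine ENNReal.ofReal_le_ofReal (upper_tail_le hδ
        (div_nonneg (blocked_nonneg _ _ _) hn.le) hq h2 ?_ (le_max_left _ _) (hΛ.trans ?_))
      · rw [hmR]
        linarith [Int.floor_le l]
      · gcongr
        exact le_max_right _ _

lemma toOuterMeasure_generate_lower {G : ICNetwork V} {Sr S : Finset V} {δ q l Λ : ℝ}
    (hδ : 0 < δ) (hl : 0 ≤ l) (hq : blocked G Sr S / Fintype.card V = q)
    (hΛ : Λ * (2 * (1 + δ) ^ 2) ≤ l * q * δ ^ 2) :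
    (generate G Sr (⌊l⌋ + 1).toNat []).toOuterMeasure
        {R | totalCover S R ≤ l * q / (1 + δ)} ≤ ENNReal.ofReal (Real.exp (-Λ)) := by
  have hn : (0 : ℝ) < Fintype.card V := by exact_mod_cast Fintype.card_pos
  set m := (⌊l⌋ + 1).toNat with hm
  have hmZ : (m : ℤ) = ⌊l⌋ + 1 := Int.toNat_of_nonneg (by have := Int.floor_nonneg.2 hl; omega)
  have hmR : (m : ℝ) = ⌊l⌋ + 1 := by exact_mod_cast hmZ
  refine (toOuterMeasure_generate_le G Sr S (z := (1 + δ)⁻¹)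
    (w := (1 + δ) ^ (l * q / (1 + δ))) (by positivity) (by positivity) m _ ?_).trans ?_
  · intro R hR
    rw [← Real.rpow_natCast, Real.inv_rpow (by linarith), ← Real.rpow_neg (by linarith),
      ← Real.rpow_add (by linarith)]
    refine Real.one_le_rpow (by linarith) ?_
    have h6 : (totalCover S R : ℝ) ≤ l * q / (1 + δ) := hR
    linarith
  · rw [hq]
    refine ENNReal.ofReal_le_ofReal (lower_tail_le hδ ?_ ?_ ?_ hΛ hl)
    · exact hq ▸ div_nonneg (blocked_nonneg _ _ _) hn.le
    · exact hq ▸ (div_le_one hn).2 (blocked_le_card _ _ _)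
    · rw [hmR]
      exact (Int.lt_floor_add_one l).le

end Tails

/-! ### The parameters of the estimation -/

section Parameters

variable {V : Type*} [Fintype V]

variable (V) in
/-- The logarithmic factor of `λ`. -/
noncomputable def logFactor (k : ℕ) (N : ℝ) : ℝ :=
  Real.log (N * ((Fintype.card V).choose k : ℝ) * Real.logb 2 (Fintype.card V))

variable (V) in
/-- The ratio `λ / n`. -/
noncomputable def lamRatio (k : ℕ) (δ N : ℝ) : ℝ := (2 + δ) * logFactor V k N / δ ^ 2

lemma lVal_eq [Nonempty V] (k : ℕ) (δ N : ℝ) (i : ℕ) :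
    lVal (Fintype.card V) k δ N i = lamRatio V k δ N * 2 ^ i := by
  have hn : (0 : ℝ) < Fintype.card V := by exact_mod_cast Fintype.card_pos
  unfold lVal lam xVal lamRatio logFactor
  field_simp

lemma one_le_choose_mul_logb {n k : ℕ} (hn : 2 ≤ n) (hkn : k ≤ n) :
    1 ≤ (n.choose k : ℝ) ∧ 1 ≤ Real.logb 2 n := by
  constructor
  · exact_mod_cast Nat.choose_pos hkn
  · rw [Real.le_logb_iff_rpow_le one_lt_two (by positivity), Real.rpow_one]
    exact_mod_cast hn

lemma one_lt_logFactor {k : ℕ} (hkn : k ≤ Fintype.card V) {N : ℝ} (hN : 3 < N)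
    (hn : 2 ≤ Fintype.card V) : 1 < logFactor V k N := by
  obtain ⟨h1, h2⟩ := one_le_choose_mul_logb hn hkn
  have h4 : 3 < N * ((Fintype.card V).choose k : ℝ) * Real.logb 2 (Fintype.card V) := by
    calc 3 < N := hN
      _ ≤ N * ((Fintype.card V).choose k : ℝ) := le_mul_of_one_le_right (by linarith) h1
      _ ≤ _ := le_mul_of_one_le_right (by positivity) h2
  rw [logFactor, Real.lt_log_iff_exp_lt (by linarith)]
  linarith [Real.exp_one_lt_d9]

lemma exp_neg_logFactor {k : ℕ} (hkn : k ≤ Fintype.card V) {N : ℝ} (hN : 3 < N)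
    (hn : 2 ≤ Fintype.card V) : Real.exp (-logFactor V k N) =
      (N * ((Fintype.card V).choose k : ℝ) * Real.logb 2 (Fintype.card V))⁻¹ := by
  obtain ⟨h1, h2⟩ := one_le_choose_mul_logb hn hkn
  rw [Real.exp_neg, logFactor, Real.exp_log]
  positivity

lemma lamRatio_nonneg [Nonempty V] {k : ℕ} (hkn : k ≤ Fintype.card V) {δ N : ℝ} (hδ : 0 < δ) (hN : 3 < N) :
    0 ≤ lamRatio V k δ N := by
  have h : 0 ≤ logFactor V k N := by
    rcases Nat.lt_or_ge (Fintype.card V) 2 with h | h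
    · have h1 : Fintype.card V = 1 := by
        have : 0 < Fintype.card V := Fintype.card_pos
        omega
      simp [logFactor, h1]
    · exact (zero_lt_one.trans (one_lt_logFactor hkn hN h)).le
  unfold lamRatio
  positivity

lemma monotone_sampleCount [Nonempty V] {k : ℕ} (hkn : k ≤ Fintype.card V) {δ N : ℝ} (hδ : 0 < δ)
    (hN : 3 < N) : Monotone fun j => (⌊lVal (Fintype.card V) k δ N j⌋ + 1).toNat := by
  intro i j hij
  have h : lVal (Fintype.card V) k δ N i ≤ lVal (Fintype.card V) k δ N j := by
    rw [lVal_eq, lVal_eq]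
    exact mul_le_mul_of_nonneg_left (pow_le_pow_right₀ one_le_two hij)
      (lamRatio_nonneg hkn hδ hN)
  have h2 := Int.floor_le_floor h
  dsimp only
  omega

lemma two_le_card_of_lastIter_pos (h : 1 ≤ lastIter (Fintype.card V)) :
    2 ≤ Fintype.card V := by
  by_contra h2
  have h3 : Fintype.card V - 1 = 0 := by omega
  simp [lastIter, h3] at h

lemma lamRatio_pos {k : ℕ} (hkn : k ≤ Fintype.card V) {δ N : ℝ} (hδ : 0 < δ) (hN : 3 < N)
    (hn : 2 ≤ Fintype.card V) : 0 < lamRatio V k δ N := by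
  have := one_lt_logFactor hkn hN hn
  unfold lamRatio
  positivity

lemma xVal_anti (n : ℕ) {i j : ℕ} (h : i ≤ j) : xVal n j ≤ xVal n i := by
  unfold xVal
  gcongr
  exact one_le_two

lemma xVal_succ (n i : ℕ) : xVal n (i + 1) = xVal n i / 2 := by
  unfold xVal
  rw [pow_succ, div_div]

lemma xVal_lastIter_le_two (n : ℕ) : xVal n (lastIter n) ≤ 2 := by
  have h : n - 1 < 2 ^ (Nat.log 2 (n - 1) + 1) := Nat.lt_pow_succ_log_self one_lt_two _
  have h2 : n ≤ 2 * 2 ^ lastIter n := by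
    rw [lastIter, ← pow_succ']
    omega
  rw [xVal, div_le_iff₀ (by positivity)]
  exact_mod_cast h2

lemma one_sub_inv_exp_bounds : 0 < 1 - 1 / Real.exp 1 ∧ 1 - 1 / Real.exp 1 < 1 := by
  have h1 : 1 / Real.exp 1 < 1 := by
    rw [div_lt_one (Real.exp_pos 1)]
    exact Real.one_lt_exp_iff.2 one_pos
  have h2 : 0 < 1 / Real.exp 1 := by positivity
  constructor <;> linarith

end Parameters

/-! ### The estimation loop -/

section Estimation

variable {V : Type*} [Fintype V] [DecidableEq V]

/-- The estimate computed in iteration `i` from the R-tuples `R`. -/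
noncomputable def estimateVal (k : ℕ) (δ N : ℝ) (pick : Finset V → List (Finset V) → V) (i : ℕ)
    (R : List (RTuple V)) : ℝ :=
  Fintype.card V * (totalCover (nodeSelection pick R k) R : ℝ) /
    (lVal (Fintype.card V) k δ N i * (1 + δ))

/-- Iteration `i` returns an estimate when its R-tuples are `R`. -/
def PassesTest (k : ℕ) (δ N : ℝ) (pick : Finset V → List (Finset V) → V) (i : ℕ)
    (R : List (RTuple V)) : Prop :=
  (1 + δ) * xVal (Fintype.card V) i ≤
    Fintype.card V * (totalCover (nodeSelection pick R k) R : ℝ) / lVal (Fintype.card V) k δ N i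

/-- Union bound over the iterations `i, …, J - 1`: the loop has a good output unless the R-tuples
of one of these iterations are bad. -/
lemma toOuterMeasure_estimateLoop_compl_le [Nonempty V] (G : ICNetwork V) (Sr : Finset V) {k : ℕ} {δ N : ℝ}
    {pick : Finset V → List (Finset V) → V}
    (hmono : Monotone fun j => (⌊lVal (Fintype.card V) k δ N j⌋ + 1).toNat)
    (Good : Set (Option ℝ)) (Bad : ℕ → Set (List (RTuple V))) (J r i : ℕ) (R : List (RTuple V))
    (hiJ : i ≤ J) (hJ : J ≤ i + r)
    (hR : R.length ≤ (⌊lVal (Fintype.card V) k δ N i⌋ + 1).toNat)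
    (hpass : ∀ j, i ≤ j → j < J → ∀ R', PassesTest k δ N pick j R' → R' ∉ Bad j →
      some (estimateVal k δ N pick j R') ∈ Good)
    (hfinal : (J = i + r ∧ none ∈ Good) ∨
      (i < J ∧ ∀ R', ¬ PassesTest k δ N pick (J - 1) R' → R' ∈ Bad (J - 1))) :
    (estimateLoop G Sr k δ N pick r i R).toOuterMeasure Goodᶜ ≤
      ∑ j ∈ Finset.Ico i J,
        (generate G Sr ((⌊lVal (Fintype.card V) k δ N j⌋ + 1).toNat - R.length) R).toOuterMeasure
          (Bad j) := by
  set m : ℕ → ℕ := fun j => (⌊lVal (Fintype.card V) k δ N j⌋ + 1).toNat with hm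
  induction r generalizing i R with
  | zero =>
    rcases hfinal with ⟨-, h⟩ | ⟨h, -⟩
    · rw [toOuterMeasure_eq_expect, estimateLoop, expect_pure]
      simp [h]
    · omega
  | succ r ih =>
    have hiJ' : i < J := by
      rcases hfinal with ⟨h, -⟩ | ⟨h, -⟩
      · omega
      · exact h
    have hloop : estimateLoop G Sr k δ N pick (r + 1) i R =
        (generate G Sr (m i - R.length) R).bind fun R' =>
          open Classical in
          if PassesTest k δ N pick i R' then PMF.pure (some (estimateVal k δ N pick i R'))
          else estimateLoop G Sr k δ N pick r (i + 1) R' := by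
      rw [estimateLoop]
      rfl
    rw [hloop, toOuterMeasure_eq_expect, expect_bind]
    calc _ ≤ expect (generate G Sr (m i - R.length) R) fun R' => (Bad i).indicator 1 R' +
          ∑ j ∈ Finset.Ico (i + 1) J,
            (generate G Sr (m j - R'.length) R').toOuterMeasure (Bad j) := by
          refine expect_mono fun R' hR' => ?_
          have hlen : R'.length = m i := by
            rw [length_of_mem_support_generate hR']
            exact Nat.sub_add_cancel hR
          rw [← toOuterMeasure_eq_expect]
          by_cases hB : R' ∈ Bad i
          · rw [Set.indicator_of_mem hB]
            exact le_add_right (toOuterMeasure_le_one _ _)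
          refine le_add_left ?_
          split_ifs with hT
          · rw [toOuterMeasure_eq_expect, expect_pure]
            simp [hpass i le_rfl hiJ' R' hT hB]
          · refine ih (i + 1) R' hiJ' (by omega) ?_ (fun j hj => hpass j (by omega)) ?_
            · rw [hlen]
              exact hmono (Nat.le_succ i)
            · rcases hfinal with ⟨h1, h2⟩ | ⟨-, h2⟩
              · exact Or.inl ⟨by omega, h2⟩
              · refine Or.inr ⟨lt_of_le_of_ne hiJ' ?_, h2⟩
                rintro rfl
                exact hB (h2 R' hT)
      _ = _ := by
          rw [expect_add, expect_sum, Finset.sum_eq_sum_Ico_succ_bot hiJ',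
            ← toOuterMeasure_eq_expect]
          congr 1
          refine Finset.sum_congr rfl fun j hj => ?_
          have hij : m i ≤ m j := hmono (by have := (Finset.mem_Ico.1 hj).1; omega)
          have hRi : R.length ≤ m i := hR
          have h1 : (⌊lVal (Fintype.card V) k δ N j⌋ + 1).toNat - R.length =
              (m i - R.length) + (m j - m i) := by
            change m j - R.length = _
            omega
          rw [h1, generate_add, toOuterMeasure_eq_expect, expect_bind]
          refine expect_congr fun R' hR' => ?_
          rw [← toOuterMeasure_eq_expect, length_of_mem_support_generate hR',
            Nat.sub_add_cancel hR]

/-- The R-tuples for which some `k` nodes have an unexpectedly large coverage. -/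
def overestimating (G : ICNetwork V) (Sr : Finset V) (k : ℕ) (δ N : ℝ) (i : ℕ) :
    Set (List (RTuple V)) :=
  ⋃ S ∈ (Finset.univ : Finset V).powersetCard k,
    {R | (1 + δ) * max (lVal (Fintype.card V) k δ N i * (OPT G Sr k / Fintype.card V))
      (lamRatio V k δ N) ≤ totalCover S R}

lemma sum_overestimating_le [Nonempty V] (G : ICNetwork V) (Sr : Finset V) {k : ℕ}
    (hkn : k ≤ Fintype.card V) {δ N : ℝ} (hδ : 0 < δ) (hN : 3 < N) {J : ℕ}
    (hJ : J ≤ 1 + lastIter (Fintype.card V)) :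
    ∑ j ∈ Finset.Ico 1 J,
      (generate G Sr (⌊lVal (Fintype.card V) k δ N j⌋ + 1).toNat []).toOuterMeasure
        (overestimating G Sr k δ N j) ≤ ENNReal.ofReal (2 / N) := by
  rcases Nat.eq_zero_or_pos (lastIter (Fintype.card V)) with h0 | h0
  · rw [Finset.Ico_eq_empty (by omega)]
    simp
  have hn := two_le_card_of_lastIter_pos h0
  have hn0 : (0 : ℝ) < Fintype.card V := by exact_mod_cast Fintype.card_pos
  have hΛ := one_lt_logFactor hkn hN hn
  obtain ⟨hC, hlog⟩ := one_le_choose_mul_logb hn hkn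
  set M := lamRatio V k δ N with hM
  have hMδ : M * δ ^ 2 = logFactor V k N * (2 + δ) := by
    rw [hM, lamRatio]
    field_simp
  have hM1 : 1 < (1 + δ) * M := by
    have h1 : δ ^ 2 < (1 + δ) * (M * δ ^ 2) := by
      rw [hMδ]
      nlinarith
    have h2 : 0 < δ ^ 2 := by positivity
    nlinarith
  have hone : ∀ j, (generate G Sr (⌊lVal (Fintype.card V) k δ N j⌋ + 1).toNat []).toOuterMeasure
      (overestimating G Sr k δ N j) ≤ ENNReal.ofReal (2 / (N * Real.logb 2 (Fintype.card V))) := by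
    intro j
    refine (MeasureTheory.measure_biUnion_finset_le _ _).trans ?_
    calc _ ≤ ∑ _S ∈ (Finset.univ : Finset V).powersetCard k,
          ENNReal.ofReal (2 * Real.exp (-logFactor V k N)) := by
          refine Finset.sum_le_sum fun S hS => ?_
          refine toOuterMeasure_generate_upper hδ ?_ ?_ hM1 hMδ.ge
          · rw [lVal_eq]
            exact mul_nonneg (lamRatio_nonneg hkn hδ hN) (by positivity)
          · gcongr
            exact blocked_le_OPT G Sr (Finset.mem_powersetCard.1 hS).2.le
      _ = _ := by
          rw [Finset.sum_const, Finset.card_powersetCard, Finset.card_univ, nsmul_eq_mul,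
            ← ENNReal.ofReal_natCast, ← ENNReal.ofReal_mul (by positivity),
            exp_neg_logFactor hkn hN hn]
          have hC0 : ((Fintype.card V).choose k : ℝ) ≠ 0 := by positivity
          congr 1
          field_simp
  have hL : (lastIter (Fintype.card V) : ℝ) ≤ Real.logb 2 (Fintype.card V) := by
    have h1 : lastIter (Fintype.card V) ≤ Nat.log 2 (Fintype.card V) :=
      Nat.log_mono_right (Nat.sub_le _ _)
    calc (lastIter (Fintype.card V) : ℝ) ≤ Nat.log 2 (Fintype.card V) := by exact_mod_cast h1
      _ ≤ _ := by exact_mod_cast Real.natLog_le_logb (Fintype.card V) 2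
  calc _ ≤ ∑ _j ∈ Finset.Ico 1 J,
        ENNReal.ofReal (2 / (N * Real.logb 2 (Fintype.card V))) :=
        Finset.sum_le_sum fun j _ => hone j
    _ = ENNReal.ofReal ((J - 1 : ℕ) * (2 / (N * Real.logb 2 (Fintype.card V)))) := by
        rw [Finset.sum_const, Nat.card_Ico, nsmul_eq_mul, ENNReal.ofReal_mul (by positivity),
          ENNReal.ofReal_natCast]
    _ ≤ _ := by
        refine ENNReal.ofReal_le_ofReal ?_
        have h1 : ((J - 1 : ℕ) : ℝ) ≤ Real.logb 2 (Fintype.card V) :=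
          le_trans (by exact_mod_cast (by omega : J - 1 ≤ lastIter (Fintype.card V))) hL
        calc _ ≤ Real.logb 2 (Fintype.card V) * (2 / (N * Real.logb 2 (Fintype.card V))) := by
              gcongr
          _ = 2 / N := by field_simp

lemma estimateVal_le_OPT [Nonempty V] {G : ICNetwork V} {Sr : Finset V} {k : ℕ}
    (hkn : k ≤ Fintype.card V) {δ N : ℝ} (hδ : 0 < δ) (hM : 0 < lamRatio V k δ N)
    {pick : Finset V → List (Finset V) → V} {i : ℕ} {R : List (RTuple V)}
    (hT : PassesTest k δ N pick i R) (hR : R ∉ overestimating G Sr k δ N i) :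
    estimateVal k δ N pick i R ≤ OPT G Sr k := by
  have hn : (0 : ℝ) < Fintype.card V := by exact_mod_cast Fintype.card_pos
  have hl : 0 < lVal (Fintype.card V) k δ N i := by
    rw [lVal_eq]
    positivity
  by_contra hlt
  rw [not_le] at hlt
  obtain ⟨S, hS, hSc⟩ := Finset.exists_superset_card_eq (card_nodeSelection_le pick R k) hkn
  refine hR (Set.mem_biUnion (Finset.mem_coe.2 (Finset.mem_powersetCard.2
    ⟨Finset.subset_univ S, hSc⟩)) ?_)
  have h1 : (totalCover (nodeSelection pick R k) R : ℝ) ≤ totalCover S R := by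
    exact_mod_cast totalCover_mono hS R
  refine le_trans ?_ h1
  rw [mul_max_of_nonneg _ _ (by linarith)]
  refine max_le ?_ ?_
  · rw [estimateVal, lt_div_iff₀ (by positivity)] at hlt
    rw [← mul_div_assoc, ← mul_div_assoc, div_le_iff₀ hn]
    linarith
  · rw [PassesTest, le_div_iff₀ hl, lVal_eq, xVal] at hT
    have h2 : (1 + δ) * (Fintype.card V / 2 ^ i) * (lamRatio V k δ N * 2 ^ i) =
        Fintype.card V * ((1 + δ) * lamRatio V k δ N) := by
      field_simp
    rw [h2] at hT
    exact le_of_mul_le_mul_left hT hn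

lemma xVal_le_estimateVal {k : ℕ} {δ N : ℝ} (hδ : 0 < δ)
    {pick : Finset V → List (Finset V) → V} {i : ℕ} {R : List (RTuple V)}
    (hT : PassesTest k δ N pick i R) :
    xVal (Fintype.card V) i ≤ estimateVal k δ N pick i R := by
  rw [estimateVal, ← div_div, le_div_iff₀ (by linarith), mul_comm]
  exact hT

lemma one_le_OPT (G : ICNetwork V) {Sr : Finset V} (hSr : Sr ≠ Finset.univ) {k : ℕ}
    (hk : 1 ≤ k) : 1 ≤ OPT G Sr k := by
  obtain ⟨v, hv⟩ : ∃ v, v ∉ Sr := by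
    by_contra! h
    exact hSr (Finset.eq_univ_iff_forall.2 h)
  exact (one_le_blocked G hv (Finset.mem_singleton_self v)).trans
    (blocked_le_OPT G Sr (by simpa using hk))

/-- The estimate is good with high probability if `OPT_k` is below the range of the loop. -/
lemma toOuterMeasure_compl_le_of_lt [Nonempty V] (G : ICNetwork V) {Sr : Finset V} (hSr : Sr ≠ Finset.univ)
    {k : ℕ} (hk : 1 ≤ k) (hkn : k ≤ Fintype.card V) {δ N : ℝ} (hδ : 0 < δ) (hN : 3 < N)
    (pick : Finset V → List (Finset V) → V)
    (hc : (1 - 1 / Real.exp 1) * OPT G Sr k / (1 + δ) ^ 2 <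
      xVal (Fintype.card V) (lastIter (Fintype.card V))) :
    (optEstimate G Sr k δ N pick).toOuterMeasure
      {o | IsGoodEstimate G Sr k δ (o.getD 1)}ᶜ ≤ ENNReal.ofReal (2 / N) := by
  have hopt := one_le_OPT G hSr hk
  set c := (1 - 1 / Real.exp 1) * OPT G Sr k / (1 + δ) ^ 2 with hcdef
  have hc2 : (1 - 1 / Real.exp 1) * OPT G Sr k / (2 * (1 + δ) ^ 2) = c / 2 := by
    rw [hcdef, div_div, mul_comm 2]
  have hc0 : 0 ≤ c := by
    have := one_sub_inv_exp_bounds.1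
    positivity
  refine (toOuterMeasure_estimateLoop_compl_le G Sr (monotone_sampleCount hkn hδ hN) _
    (overestimating G Sr k δ N) (1 + lastIter (Fintype.card V)) _ 1 [] (by omega) le_rfl
    (Nat.zero_le _) ?_ (Or.inl ⟨rfl, ?_⟩)).trans (sum_overestimating_le G Sr hkn hδ hN le_rfl)
  · intro j hj1 hj R hT hR
    refine ⟨estimateVal_le_OPT hkn hδ (lamRatio_pos hkn hδ hN
      (two_le_card_of_lastIter_pos (by omega))) hT hR, ?_⟩
    rw [hc2]
    have h1 := xVal_le_estimateVal hδ hT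
    have h2 := xVal_anti (Fintype.card V) (by omega : j ≤ lastIter (Fintype.card V))
    simp only [Option.getD_some]
    linarith
  · refine ⟨hopt, ?_⟩
    rw [hc2]
    have := xVal_lastIter_le_two (Fintype.card V)
    simp only [Option.getD_none]
    linarith

/-- A good estimate is returned with high probability if `OPT_k` is within the range of the
loop. -/
lemma toOuterMeasure_compl_le_of_le [Nonempty V] (G : ICNetwork V) (Sr : Finset V)
    {k : ℕ} (hk : 1 ≤ k) (hkn : k ≤ Fintype.card V) {δ N : ℝ} (hδ : 0 < δ) (hN : 3 < N)
    {pick : Finset V → List (Finset V) → V} (hpick : IsGreedyRule pick)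
    (hc : xVal (Fintype.card V) (lastIter (Fintype.card V)) ≤
      (1 - 1 / Real.exp 1) * OPT G Sr k / (1 + δ) ^ 2) :
    (optEstimate G Sr k δ N pick).toOuterMeasure
      {o | ∃ y : ℝ, o = some y ∧ IsGoodEstimate G Sr k δ y}ᶜ ≤ ENNReal.ofReal (3 / N) := by
  classical
  have hn0 : (0 : ℝ) < Fintype.card V := by exact_mod_cast Fintype.card_pos
  obtain ⟨he0, he1⟩ := one_sub_inv_exp_bounds
  obtain ⟨S, hSk, hS⟩ := exists_blocked_eq_OPT G Sr k
  have hoptn : OPT G Sr k ≤ Fintype.card V := hS ▸ blocked_le_card G Sr S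
  have hopt0 : 0 ≤ OPT G Sr k := hS ▸ blocked_nonneg G Sr S
  set e' := 1 - 1 / Real.exp 1 with he'
  set c := e' * OPT G Sr k / (1 + δ) ^ 2 with hcdef
  have hc2 : e' * OPT G Sr k / (2 * (1 + δ) ^ 2) = c / 2 := by
    rw [hcdef, div_div, mul_comm 2]
  have hcn : c < xVal (Fintype.card V) 0 := by
    rw [xVal, pow_zero, div_one, hcdef, div_lt_iff₀ (by positivity)]
    have h1 : 1 ≤ (1 + δ) ^ 2 := one_le_pow₀ (by linarith)
    nlinarith
  -- the iteration at which the test has to succeed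
  have hex : ∃ i, xVal (Fintype.card V) i ≤ c := ⟨_, hc⟩
  obtain ⟨i, hi, hmin⟩ : ∃ i, xVal (Fintype.card V) (i + 1) ≤ c ∧
      c < xVal (Fintype.card V) i := by
    have h1 : Nat.find hex ≠ 0 := fun h => by
      have := Nat.find_spec hex
      rw [h] at this
      linarith
    obtain ⟨i, hi⟩ := Nat.exists_eq_succ_of_ne_zero h1
    have h2 := Nat.find_spec hex
    rw [hi] at h2
    exact ⟨i, h2, not_le.1 (Nat.find_min hex (by omega))⟩
  have hiL : i + 1 ≤ lastIter (Fintype.card V) := by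
    by_contra h
    have := xVal_anti (Fintype.card V) (by omega : lastIter (Fintype.card V) ≤ i)
    linarith
  have hn := two_le_card_of_lastIter_pos (by omega : 1 ≤ lastIter (Fintype.card V))
  have hM := lamRatio_pos hkn hδ hN hn
  have hΛ := one_lt_logFactor hkn hN hn
  obtain ⟨hC, hlog⟩ := one_le_choose_mul_logb hn hkn
  set M := lamRatio V k δ N with hMdef
  have hMδ : M * δ ^ 2 = logFactor V k N * (2 + δ) := by
    rw [hMdef, lamRatio]
    field_simp
  set l := lVal (Fintype.card V) k δ N (i + 1) with hldef
  have hl : l = M * 2 ^ (i + 1) := lVal_eq k δ N (i + 1)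
  have hl0 : 0 < l := by
    rw [hl]
    positivity
  set q := OPT G Sr k / Fintype.card V with hqdef
  have hlq : M * (1 + δ) ^ 2 ≤ e' * (l * q) := by
    rw [xVal, hcdef, div_le_div_iff₀ (by positivity) (by positivity)] at hi
    have h1 : e' * (l * q) = M * (e' * OPT G Sr k * 2 ^ (i + 1)) / Fintype.card V := by
      rw [hl, hqdef]
      ring
    rw [h1, le_div_iff₀ hn0]
    nlinarith
  have hlq0 : 0 ≤ l * q := by positivity
  -- the coverage of an optimal set in that iteration
  let Low : ℕ → Set (List (RTuple V)) := fun j =>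
    if j = i + 1 then {R | totalCover S R ≤ l * q / (1 + δ)} else ∅
  have hlow : (generate G Sr (⌊l⌋ + 1).toNat []).toOuterMeasure
      {R | totalCover S R ≤ l * q / (1 + δ)} ≤ ENNReal.ofReal (1 / N) := by
    refine (toOuterMeasure_generate_lower (Λ := logFactor V k N) hδ hl0.le (by rw [hqdef, hS])
      ?_).trans (ENNReal.ofReal_le_ofReal ?_)
    · have h1 : M * (1 + δ) ^ 2 ≤ l * q := by nlinarith
      calc logFactor V k N * (2 * (1 + δ) ^ 2)
          ≤ logFactor V k N * ((2 + δ) * (1 + δ) ^ 2) := by gcongr; linarith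
        _ = M * (1 + δ) ^ 2 * δ ^ 2 := by
            rw [mul_right_comm M, hMδ]
            ring
        _ ≤ _ := by gcongr
    · rw [exp_neg_logFactor hkn hN hn, ← one_div]
      refine one_div_le_one_div_of_le (by linarith) ?_
      rw [mul_assoc]
      exact le_mul_of_one_le_right (by linarith) (one_le_mul_of_one_le_of_one_le hC hlog)
  refine (toOuterMeasure_estimateLoop_compl_le G Sr (monotone_sampleCount hkn hδ hN) _
    (fun j => overestimating G Sr k δ N j ∪ Low j) (i + 2) _ 1 [] (by omega) (by omega)
    (Nat.zero_le _) ?_ (Or.inr ⟨by omega, ?_⟩)).trans ?_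
  · intro j hj1 hj R hT hR
    refine ⟨_, rfl, estimateVal_le_OPT hkn hδ hM hT fun h => hR (Or.inl h), ?_⟩
    rw [hc2]
    have h1 := xVal_le_estimateVal hδ hT
    have h2 := xVal_anti (Fintype.card V) (by omega : j ≤ i + 1)
    rw [xVal_succ] at h2
    linarith
  · intro R hT
    right
    have h0 : i + 2 - 1 = i + 1 := rfl
    rw [h0] at hT ⊢
    simp only [Low, if_true, Set.mem_ofPred_eq]
    by_contra hlt
    rw [not_le, div_lt_iff₀ (by linarith)] at hlt
    refine hT ?_
    rw [PassesTest, le_div_iff₀ hl0, hl, xVal]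
    have h2 : (1 + δ) * (Fintype.card V / 2 ^ (i + 1)) * (M * 2 ^ (i + 1)) =
        Fintype.card V * ((1 + δ) * M) := by
      field_simp
    rw [h2]
    refine mul_le_mul_of_nonneg_left (le_trans ?_
      (totalCover_nodeSelection_ge hpick hk hkn hSk R)) hn0.le
    have h3 : (1 + δ) * ((1 + δ) * M) ≤ (1 + δ) * (e' * totalCover S R) := by
      have := mul_le_mul_of_nonneg_left hlt.le he0.le
      nlinarith
    exact le_of_mul_le_mul_left h3 (by linarith)
  · calc _ ≤ ∑ j ∈ Finset.Ico 1 (i + 2),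
          ((generate G Sr (⌊lVal (Fintype.card V) k δ N j⌋ + 1).toNat []).toOuterMeasure
            (overestimating G Sr k δ N j) +
          (generate G Sr (⌊lVal (Fintype.card V) k δ N j⌋ + 1).toNat []).toOuterMeasure
            (Low j)) := Finset.sum_le_sum fun j _ => MeasureTheory.measure_union_le _ _
      _ ≤ ENNReal.ofReal (2 / N) + ENNReal.ofReal (1 / N) := by
          rw [Finset.sum_add_distrib]
          refine add_le_add (sum_overestimating_le G Sr hkn hδ hN (by omega)) ?_
          rw [Finset.sum_eq_single (i + 1)]
          · simpa [Low] using hlow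
          · intro j _ hj
            simp [Low, hj]
          · intro h
            exact absurd (Finset.mem_Ico.2 ⟨by omega, by omega⟩) h
      _ = _ := by
          rw [← ENNReal.ofReal_add (by positivity) (by positivity)]
          congr 1
          ring

end Estimation

end RumorBlocking

open RumorBlocking in
theorem mainTheorem2 {V : Type*} [Fintype V] [DecidableEq V] [Nonempty V]
    (G : ICNetwork V) (Sr : Finset V) (hSr : Sr ≠ Finset.univ)
    (k : ℕ) (hk : 1 ≤ k) (hkn : k ≤ Fintype.card V)
    (δ N : ℝ) (hδ : 0 < δ) (hN : 0 < N)
    (pick : Finset V → List (Finset V) → V) (hpick : IsGreedyRule pick) :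
    -- the estimate, completed by the trivial lower bound `1` if no iteration returns a value
    ENNReal.ofReal (1 - 3 / N) ≤
        (optEstimate G Sr k δ N pick).toOuterMeasure
          {o | IsGoodEstimate G Sr k δ (o.getD 1)} ∧
    (xVal (Fintype.card V) (lastIter (Fintype.card V)) ≤
          (1 - 1 / Real.exp 1) * OPT G Sr k / (1 + δ) ^ 2 →
      ENNReal.ofReal (1 - 3 / N) ≤
        (optEstimate G Sr k δ N pick).toOuterMeasure
          {o | ∃ y : ℝ, o = some y ∧ IsGoodEstimate G Sr k δ y}) := by
  rcases le_or_gt N 3 with hN3 | hN3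
  · have h1 : ENNReal.ofReal (1 - 3 / N) = 0 := by
      rw [ENNReal.ofReal_eq_zero, sub_nonpos, one_le_div hN]
      exact hN3
    rw [h1]
    exact ⟨zero_le, fun _ => zero_le⟩
  have h1 : ENNReal.ofReal (1 - 3 / N) = 1 - ENNReal.ofReal (3 / N) := by
    rw [ENNReal.ofReal_sub _ (by positivity), ENNReal.ofReal_one]
  have h2 : xVal (Fintype.card V) (lastIter (Fintype.card V)) ≤
        (1 - 1 / Real.exp 1) * OPT G Sr k / (1 + δ) ^ 2 →
      ENNReal.ofReal (1 - 3 / N) ≤ (optEstimate G Sr k δ N pick).toOuterMeasure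
          {o | ∃ y : ℝ, o = some y ∧ IsGoodEstimate G Sr k δ y} := fun hc => by
    rw [h1]
    exact one_sub_le_toOuterMeasure _ _
      (toOuterMeasure_compl_le_of_le G Sr hk hkn hδ hN3 hpick hc)
  refine ⟨?_, h2⟩
  rcases le_or_gt (xVal (Fintype.card V) (lastIter (Fintype.card V)))
    ((1 - 1 / Real.exp 1) * OPT G Sr k / (1 + δ) ^ 2) with hc | hc
  · refine (h2 hc).trans (MeasureTheory.measure_mono ?_)
    rintro o ⟨y, rfl, hy⟩
    exact hy
  · rw [h1]
    refine one_sub_le_toOuterMeasure _ _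
      ((toOuterMeasure_compl_le_of_lt G hSr hk hkn hδ hN3 pick hc).trans ?_)
    refine ENNReal.ofReal_le_ofReal ?_
    gcongr
    norm_num
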